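/- A plane binary tree is a rooted plane tree each of whose vertices has either two children (a left and a right one; such a vertex is called internal) or no children (such a vertex is a leaf); its size is its number of internal vertices. For integers $a,b\ge 0$ put $$C(a,b)=\frac{(a+1)(2a+1)(a+3b+3)}{(a+b+1)(a+b+2)(2(a+b)+3)} .$$ The leaf-growth measure of a plane binary tree $t$ is the probability measure $\nu_t$ on the set of leaves of $t$ given by $\nu_t(l)=\prod_{i=1}^{|l|}C(a_i,b_i)$, where $|l|$ is the height of the leaf $l$, $a_i$ is the size of the subtree of descendants of the ancestor $v_i$ of $l$ at height $i$ (with $v_{|l|}=l$), and $b_i$ is the size of the subtree of descendants of the sibling of $v_i$. **Theorem.** For each $n$ let $\tau_n$ be uniformly distributed on the set of plane binary trees of size $n$, and set $\gamma=3(2-\sqrt3)$. Then for every $\varepsilon>0$ the following hold. 1. $\nu_{\tau_n}\bigl(\{l \text{ leaf of } \tau_n : n^{-\gamma-\varepsilon}\le \nu_{\tau_n}(l)\le n^{-\gamma+\varepsilon}\}\bigr)\to 1$ in probability as $n\to\infty$. 2. For every $\delta\in(0,1)$, with probability tending to $1$ as $n\to\infty$ there is a set $A$ of leaves of $\tau_n$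 with $\nu_{\tau_n}(A)\ge 1-\delta$ and $|A|\le n^{\gamma+\varepsilon}$. 3. $\max\{\nu_{\tau_n}(A) : A \text{ a set of leaves of } \tau_n,\ |A|\le n^{\gamma-\varepsilon}\}\to 0$ in probability as $n\to\infty$. Moreover, if, conditionally on $\tau_n$, $L_n$ is a random leaf of $\tau_n$ with law $\nu_{\tau_n}$ and $M_n=\nu_{\tau_n}(L_n)$, then $-\log M_n/\log n\to\gamma$ in probability as $n\to\infty$. -/

import Mathlib

open MeasureTheory ProbabilityTheory Filter Topology

/-- The discrete σ-algebra on the countable set of plane binary trees. A plane binary tree is a term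
of `BinaryTree Unit`: `nil` is the tree reduced to a single leaf, `node () a b` has left subtree `a`
and right subtree `b`, and the size (number of internal vertices) is `numNodes`. -/
instance instMeasurableSpaceBinaryTreeUnit : MeasurableSpace (BinaryTree Unit) := ⊤

instance instDiscreteMeasurableSpaceBinaryTreeUnit : DiscreteMeasurableSpace (BinaryTree Unit) :=
  ⟨fun _ => trivial⟩

namespace LeafGrowth

/-- The leaves of a plane binary tree. A leaf is recorded by the path from the root to it: a word in
which `false` means "go to the left child" and `true` means "go to the right child". -/
def leaves : BinaryTree Unit → Finset (List Bool)
  | .nil => {[]}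
  | .node _ a b => (leaves a).image (List.cons false) ∪ (leaves b).image (List.cons true)

/-- The rational function `C(a,b)`: the mass that the leaf-growth measure gives to a subtree of size
`a` hanging from the root, when the other subtree has size `b`. -/
noncomputable def C (a b : ℕ) : ℝ :=
  (((a : ℝ) + 1) * (2 * a + 1) * (a + 3 * b + 3)) /
    (((a : ℝ) + b + 1) * (a + b + 2) * (2 * (a + b) + 3))

/-- The leaf-growth mass `ν_t(l)` of the leaf `l` of `t`: the product, over the non-root vertices
`v` on the path from the root to `l` (with `l` included), of `C(a_v, b_v)`, where `a_v` is the size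
of the subtree of descendants of `v` and `b_v` that of the sibling of `v`.
It is `0` for words that are not leaves of `t`. -/
noncomputable def mass : BinaryTree Unit → List Bool → ℝ
  | .nil, [] => 1
  | .nil, _ :: _ => 0
  | .node _ _ _, [] => 0
  | .node _ a b, false :: l => C a.numNodes b.numNodes * mass a l
  | .node _ a b, true :: l => C b.numNodes a.numNodes * mass b l

/-- The leaf-growth measure `ν_t(A)` of a finite set `A` of leaves. -/
noncomputable def leafGrowth (t : BinaryTree Unit) (A : Finset (List Bool)) : ℝ :=
  ∑ l ∈ A, mass t l

theorem C_add_C (a b : ℕ) : C a b + C b a = 1 := by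
  unfold C
  field_simp
  ring

/-- The leaf-growth measure is a probability measure on the leaves. -/
theorem leafGrowth_leaves (t : BinaryTree Unit) : leafGrowth t (leaves t) = 1 := by
  unfold leafGrowth
  induction t with
  | nil => simp [leaves, mass]
  | node v a b iha ihb =>
    have hd : Disjoint ((leaves a).image (List.cons false))
        ((leaves b).image (List.cons true)) := by
      rw [Finset.disjoint_left]
      intro x hx hy
      simp only [Finset.mem_image] at hx hy
      obtain ⟨y, -, rfl⟩ := hx
      obtain ⟨z, -, hz⟩ := hy
      simp at hz
    rw [leaves, Finset.sum_union hd, Finset.sum_image (by simp), Finset.sum_image (by simp)]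
    simp only [mass, ← Finset.mul_sum, iha, ihb, mul_one]
    exact C_add_C _ _

/-- The leaves of `t` whose leaf-growth mass lies in `[x, y]`. -/
noncomputable def leavesWithMassIn (t : BinaryTree Unit) (x y : ℝ) : Finset (List Bool) :=
  (leaves t).filter fun l => x ≤ mass t l ∧ mass t l ≤ y

/-- The maximal leaf-growth measure of a set of at most `x` leaves of `t` (for `x ≥ 0`; it is the
supremum of a finite nonempty set, the empty set of leaves being allowed). -/
noncomputable def maxLeafGrowth (t : BinaryTree Unit) (x : ℝ) : ℝ :=
  sSup {m : ℝ | ∃ A ⊆ leaves t, (A.card : ℝ) ≤ x ∧ m = leafGrowth t A}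

/-- The exponent `γ = 3(2 - √3)`. -/
noncomputable def gammaExp : ℝ := 3 * (2 - √3)

end LeafGrowth

/-! Sample a leaf of a uniform tree from its leaf-growth measure and follow the path from the root.
The sizes of the successive subtrees form a Markov chain: given its size, each subtree on the path
is again uniform, and the chain steps from `n + 1` to `k` with probability `stepProb n k`. The
quantity `-log ν(l)` is the sum of the costs `stepCost` along this chain.

The step law has a closed distribution function (`stepProb_eq_stepCdf_sub`). Summation by parts
(`stepMean_eq_arcMean`) therefore turns a mean over one step into a mean under the discrete arcsine
law, up to the factor `stepRate N / N`. Two test functions are tuned to this formula: `logHarm`,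
which is `log` up to a bounded error and decreases in mean by exactly `stepRate N`, and `potential`,
which is bounded and decreases in mean by at least `stepRate N / (2 N)`.

The mean cost of a step is `γ * stepRate N` up to `O(stepRate N / N)`. Here `γ = 6 - 3√3` because
the arcsine mean of `1 / (3 - 2x)` is `1 / √3`, with error `O(1 / n)`
(`exists_abs_arcMean_inv_sub_le`). The centred costs `stepDev` hence have a total mean bounded by
means of `potential`. Their second moments are `O(stepRate N)`, so the sum has second moment `O(log
n)`, by comparison with `logHarm`.

Chebyshev's inequality then shows that leaves whose mass is not `n ^ (-γ ± ε)` carry mean mass `O(1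
/ log n)` (`tendsto_unifMean_atypicalLeaves`). The four assertions follow by counting leaves and
Markov's inequality. -/

namespace LeafGrowth

/-! ### Return probabilities of the simple random walk. -/

/-- The probability `binom(2k, k) / 4^k` that a simple random walk is at `0` at time `2k`. -/
noncomputable def returnProb (k : ℕ) : ℝ := (k.centralBinom : ℝ) / 4 ^ k

theorem returnProb_zero : returnProb 0 = 1 := by simp [returnProb]

theorem returnProb_pos (k : ℕ) : 0 < returnProb k := by
  unfold returnProb
  have := Nat.centralBinom_pos k
  positivity

theorem succ_mul_returnProb_succ (k : ℕ) :
    ((k : ℝ) + 1) * returnProb (k + 1) = (k + 1 / 2) * returnProb k := by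
  have h : ((k : ℝ) + 1) * (k + 1).centralBinom = 2 * (2 * k + 1) * k.centralBinom := by
    exact_mod_cast Nat.succ_mul_centralBinom_succ k
  unfold returnProb
  rw [← mul_div_assoc, h, pow_succ]
  field_simp
  ring

theorem returnProb_le_one (k : ℕ) : returnProb k ≤ 1 := by
  unfold returnProb
  rw [div_le_one (by positivity)]
  exact_mod_cast Nat.centralBinom_le_four_pow k

theorem returnProb_succ_le_half (k : ℕ) : returnProb (k + 1) ≤ 1 / 2 := by
  induction k with
  | zero =>
    have := succ_mul_returnProb_succ 0
    rw [returnProb_zero] at this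
    norm_num at this ⊢
    linarith
  | succ k ih =>
    have h := succ_mul_returnProb_succ (k + 1)
    have hp := returnProb_pos (k + 1)
    push_cast at h
    have : returnProb (k + 1 + 1) ≤ returnProb (k + 1) := by
      have hk : (0 : ℝ) < (k : ℝ) + 1 + 1 := by positivity
      refine le_of_mul_le_mul_left ?_ hk
      rw [h]
      nlinarith
    linarith

/-! ### The discrete arcsine law and its moments. -/

/-- The mean of `φ` under the discrete arcsine law on `{0, …, n}`, which gives to `m` the mass
`returnProb m * returnProb (n - m)`. -/
noncomputable def arcMean (n : ℕ) (φ : ℕ → ℝ) : ℝ :=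
  ∑ p ∈ Finset.HasAntidiagonal.antidiagonal n, returnProb p.1 * returnProb p.2 * φ p.1

theorem arcMean_eq_sum_range (n : ℕ) (φ : ℕ → ℝ) :
    arcMean n φ = ∑ m ∈ Finset.range (n + 1), returnProb m * returnProb (n - m) * φ m :=
  Finset.Nat.sum_antidiagonal_eq_sum_range_succ
    (fun i j => returnProb i * returnProb j * φ i) n

theorem arcMean_add (n : ℕ) (φ ψ : ℕ → ℝ) :
    arcMean n (fun m => φ m + ψ m) = arcMean n φ + arcMean n ψ := by
  simp only [arcMean, mul_add, Finset.sum_add_distrib]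

theorem arcMean_sub (n : ℕ) (φ ψ : ℕ → ℝ) :
    arcMean n (fun m => φ m - ψ m) = arcMean n φ - arcMean n ψ := by
  simp only [arcMean, mul_sub, Finset.sum_sub_distrib]

theorem arcMean_const_mul (n : ℕ) (c : ℝ) (φ : ℕ → ℝ) :
    arcMean n (fun m => c * φ m) = c * arcMean n φ := by
  simp only [arcMean, Finset.mul_sum]
  exact Finset.sum_congr rfl fun p _ => by ring

theorem arcMean_congr {n : ℕ} {φ ψ : ℕ → ℝ} (h : ∀ m ≤ n, φ m = ψ m) :
    arcMean n φ = arcMean n ψ := by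
  refine Finset.sum_congr rfl fun p hp => ?_
  rw [h _ (Finset.HasAntidiagonal.antidiagonal.fst_le hp)]

theorem arcMean_mono {n : ℕ} {φ ψ : ℕ → ℝ} (h : ∀ m ≤ n, φ m ≤ ψ m) :
    arcMean n φ ≤ arcMean n ψ := by
  refine Finset.sum_le_sum fun p hp => ?_
  exact mul_le_mul_of_nonneg_left (h _ (Finset.HasAntidiagonal.antidiagonal.fst_le hp))
    (mul_nonneg (returnProb_pos _).le (returnProb_pos _).le)

/-- The ratio of consecutive return probabilities, followed by an index shift. The factor `m` kills
the term `m = 0`, where `m - 1` is truncated. This is the source of all moment recursions below. -/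
theorem arcMean_succ_mul (n : ℕ) (φ : ℕ → ℝ) :
    arcMean (n + 1) (fun m => m * φ (m - 1)) = arcMean n (fun m => (m + 1 / 2) * φ m) := by
  unfold arcMean
  rw [Finset.Nat.sum_antidiagonal_succ]
  simp only [Nat.cast_zero, zero_mul, mul_zero, zero_add, Nat.add_sub_cancel]
  refine Finset.sum_congr rfl fun p _ => ?_
  have h := succ_mul_returnProb_succ p.1
  push_cast
  linear_combination returnProb p.2 * φ p.1 * h

theorem arcMean_id_eq_half (n : ℕ) :
    arcMean n (fun m => (m : ℝ)) = n / 2 * arcMean n (fun _ => 1) := by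
  have h : arcMean n (fun m => (m : ℝ)) =
      ∑ p ∈ Finset.HasAntidiagonal.antidiagonal n, returnProb p.1 * returnProb p.2 * (p.2 : ℝ) := by
    rw [arcMean, ← Finset.Nat.sum_antidiagonal_swap]
    refine Finset.sum_congr rfl fun p _ => ?_
    simp only [Prod.fst_swap, Prod.snd_swap]
    ring
  have h2 : arcMean n (fun m => (m : ℝ)) + arcMean n (fun m => (m : ℝ)) =
      n * arcMean n (fun _ => 1) := by
    nth_rewrite 2 [h]
    rw [arcMean, arcMean, ← Finset.sum_add_distrib, Finset.mul_sum]
    refine Finset.sum_congr rfl fun p hp => ?_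
    rw [← Finset.HasAntidiagonal.mem_antidiagonal.1 hp]
    push_cast
    ring
  linarith

/-- With `s n` the total mass, symmetry makes the first moment `n / 2 * s n`, and the shift identity
then gives `(n + 1) / 2 * s (n + 1) = (n + 1) / 2 * s n`. -/
theorem arcMean_one (n : ℕ) : arcMean n (fun _ => 1) = 1 := by
  induction n with
  | zero => simp [arcMean, returnProb_zero]
  | succ n ih =>
    have h1 := arcMean_succ_mul n (fun _ => 1)
    have h2 := arcMean_id_eq_half (n + 1)
    have h3 := arcMean_id_eq_half n
    simp only [mul_one] at h1
    rw [arcMean_add, h2, h3, ih] at h1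
    have h4 : arcMean n (fun _ => 1 / 2) = 1 / 2 := by
      have := arcMean_const_mul n (1 / 2) (fun _ => 1)
      simpa [ih] using this
    rw [h4] at h1
    push_cast at h1
    have hn : (0 : ℝ) < (n : ℝ) + 1 := by positivity
    have : ((n : ℝ) + 1) * arcMean (n + 1) (fun _ => 1) = (n + 1) * 1 := by linarith
    exact mul_left_cancel₀ hn.ne' this

theorem arcMean_const (n : ℕ) (c : ℝ) : arcMean n (fun _ => c) = c := by
  simpa [arcMean_one] using arcMean_const_mul n c (fun _ => 1)

theorem arcMean_id (n : ℕ) : arcMean n (fun m => (m : ℝ)) = n / 2 := by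
  rw [arcMean_id_eq_half, arcMean_one, mul_one]

theorem abs_arcMean_le {n : ℕ} {φ : ℕ → ℝ} {c : ℝ} (h : ∀ m ≤ n, |φ m| ≤ c) :
    |arcMean n φ| ≤ c := by
  rw [abs_le]
  constructor
  · rw [← arcMean_const n (-c)]
    exact arcMean_mono fun m hm => (abs_le.1 (h m hm)).1
  · rw [← arcMean_const n c]
    exact arcMean_mono fun m hm => (abs_le.1 (h m hm)).2

/-- Factorial moments are exact: by the shift identity, both sides satisfy the same Pascal-type
recursion in `n` and `j`. -/
theorem arcMean_choose (n j : ℕ) :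
    arcMean n (fun m => (m.choose j : ℝ)) = returnProb j * n.choose j := by
  induction j generalizing n with
  | zero => simp [arcMean_one, returnProb_zero]
  | succ j ihj =>
    induction n with
    | zero => simp [arcMean]
    | succ n ihn =>
      have h := arcMean_succ_mul n (fun m => (m.choose j : ℝ))
      have hl : arcMean (n + 1) (fun m => (m : ℝ) * ((m - 1).choose j : ℝ)) =
          (j + 1) * arcMean (n + 1) (fun m => (m.choose (j + 1) : ℝ)) := by
        rw [← arcMean_const_mul]
        refine arcMean_congr fun m _ => ?_
        cases m with
        | zero => simp
        | succ m =>
          have := Nat.add_one_mul_choose_eq m j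
          rw [Nat.add_sub_cancel]
          have h' : ((m : ℝ) + 1) * m.choose j = (m + 1).choose (j + 1) * (j + 1) := by
            exact_mod_cast this
          push_cast
          linarith
      have hr : arcMean n (fun m => ((m : ℝ) + 1 / 2) * (m.choose j : ℝ)) =
          (j + 1) * arcMean n (fun m => (m.choose (j + 1) : ℝ)) +
            (j + 1 / 2) * arcMean n (fun m => (m.choose j : ℝ)) := by
        rw [← arcMean_const_mul, ← arcMean_const_mul, ← arcMean_add]
        refine arcMean_congr fun m _ => ?_
        have h1 := Nat.add_one_mul_choose_eq m j
        have h2 := Nat.choose_succ_succ' m j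
        have h1' : ((m : ℝ) + 1) * m.choose j = (m + 1).choose (j + 1) * (j + 1) := by
          exact_mod_cast h1
        have h2' : ((m + 1).choose (j + 1) : ℝ) = m.choose j + m.choose (j + 1) := by
          exact_mod_cast h2
        rw [h2'] at h1'
        linarith
      rw [hl, hr, ihn, ihj] at h
      have hu := succ_mul_returnProb_succ j
      have hc : ((n + 1).choose (j + 1) : ℝ) = n.choose j + n.choose (j + 1) := by
        exact_mod_cast Nat.choose_succ_succ' n j
      have hj : (0 : ℝ) < (j : ℝ) + 1 := by positivity
      refine mul_left_cancel₀ hj.ne' ?_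
      rw [h, hc]
      linear_combination -(n.choose j : ℝ) * hu

theorem abs_pow_sub_descFactorial_le {n : ℕ} (hn : 0 < n) {m : ℕ} (hm : m ≤ n) (j : ℕ) :
    |((m : ℝ) / n) ^ j - m.descFactorial j / (n : ℝ) ^ j| ≤ (j : ℝ) ^ 2 / n := by
  have hn' : (0 : ℝ) < n := by exact_mod_cast hn
  have hx0 : (0 : ℝ) ≤ (m : ℝ) / n := by positivity
  have hx1 : (m : ℝ) / n ≤ 1 := by
    rw [div_le_one hn']
    exact_mod_cast hm
  induction j with
  | zero => simp
  | succ j ih =>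
    set N : ℝ := m.descFactorial j / (n : ℝ) ^ j with hN
    have hN0 : 0 ≤ N := by positivity
    have hN1 : N ≤ 1 := by
      rw [hN, div_le_one (by positivity)]
      exact_mod_cast (Nat.descFactorial_le_pow m j).trans (Nat.pow_le_pow_left hm j)
    have hrec : (m.descFactorial (j + 1) : ℝ) / (n : ℝ) ^ (j + 1) = N * ((m - j) / n) := by
      rw [hN, Nat.descFactorial_succ]
      rcases le_or_gt j m with h | h
      · push_cast [Nat.cast_sub h]
        rw [pow_succ]
        field_simp
      · rw [Nat.descFactorial_of_lt h]
        simp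
    rw [hrec]
    have : ((m : ℝ) / n) ^ (j + 1) - N * ((m - j) / n) =
        (m : ℝ) / n * (((m : ℝ) / n) ^ j - N) + N * (j / n) := by
      rw [pow_succ]
      field_simp
      ring
    rw [this]
    calc _ ≤ |(m : ℝ) / n * (((m : ℝ) / n) ^ j - N)| + |N * (j / n)| := abs_add_le _ _
      _ ≤ 1 * ((j : ℝ) ^ 2 / n) + 1 * (j / n) := by
        rw [abs_mul, abs_of_nonneg hx0, abs_of_nonneg (by positivity : 0 ≤ N * ((j : ℝ) / n))]
        gcongr
      _ ≤ _ := by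
        rw [one_mul, one_mul, ← add_div]
        gcongr
        push_cast
        nlinarith [(Nat.cast_nonneg j : (0 : ℝ) ≤ j)]

/-- The limit `returnProb j` is the `j`-th moment of the continuous arcsine law. Powers are replaced
by falling factorials, whose means are exact; the replacement is made once for `m` and once for `n`,
each at cost `j ^ 2 / n`. -/
theorem abs_arcMean_pow_sub_le {n : ℕ} (hn : 0 < n) (j : ℕ) :
    |arcMean n (fun m => ((m : ℝ) / n) ^ j) - returnProb j| ≤ 2 * (j : ℝ) ^ 2 / n := by
  have hn' : (0 : ℝ) < n := by exact_mod_cast hn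
  have h1 : |arcMean n (fun m => ((m : ℝ) / n) ^ j - m.descFactorial j / (n : ℝ) ^ j)| ≤
      (j : ℝ) ^ 2 / n :=
    abs_arcMean_le fun m hm => abs_pow_sub_descFactorial_le hn hm j
  have h2 := abs_pow_sub_descFactorial_le hn le_rfl j
  rw [div_self hn'.ne', one_pow] at h2
  have h3 : arcMean n (fun m => (m.descFactorial j : ℝ) / (n : ℝ) ^ j) =
      returnProb j * (n.descFactorial j / (n : ℝ) ^ j) := by
    have : ∀ m : ℕ, (m.descFactorial j : ℝ) / (n : ℝ) ^ j =
        (j.factorial / (n : ℝ) ^ j) * m.choose j := by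
      intro m
      rw [Nat.descFactorial_eq_factorial_mul_choose]
      push_cast
      ring
    simp_rw [this]
    rw [arcMean_const_mul, arcMean_choose]
    ring
  rw [arcMean_sub, h3] at h1
  have h4 : |returnProb j * (n.descFactorial j / (n : ℝ) ^ j) - returnProb j| ≤
      (j : ℝ) ^ 2 / n := by
    have : returnProb j * (n.descFactorial j / (n : ℝ) ^ j) - returnProb j =
        -(returnProb j * (1 - n.descFactorial j / (n : ℝ) ^ j)) := by ring
    rw [this, abs_neg, abs_mul, abs_of_pos (returnProb_pos j)]
    calc _ ≤ 1 * ((j : ℝ) ^ 2 / n) := by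
          gcongr
          exact returnProb_le_one j
      _ = _ := one_mul _
  have := abs_add_le (arcMean n (fun m => ((m : ℝ) / n) ^ j) -
    returnProb j * (n.descFactorial j / (n : ℝ) ^ j))
    (returnProb j * (n.descFactorial j / (n : ℝ) ^ j) - returnProb j)
  rw [sub_add_sub_cancel] at this
  refine this.trans ?_
  rw [two_mul, add_div]
  exact add_le_add h1 h4

/-! ### Generating function of the return probabilities and the constant `1 / √3`. -/

theorem summable_returnProb_mul_pow {z : ℝ} (h0 : 0 ≤ z) (h1 : z < 1) :
    Summable fun j => returnProb j * z ^ j := by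
  refine Summable.of_nonneg_of_le (fun j => ?_) (fun j => ?_) (summable_geometric_of_lt_one h0 h1)
  · have := returnProb_pos j
    positivity
  · exact mul_le_of_le_one_left (by positivity) (returnProb_le_one j)

/-- The Cauchy square of the series is the geometric series, because the arcsine weights sum to one.
-/
theorem tsum_returnProb_mul_pow {z : ℝ} (h0 : 0 ≤ z) (h1 : z < 1) :
    ∑' j, returnProb j * z ^ j = √((1 - z)⁻¹) := by
  have hs := summable_returnProb_mul_pow h0 h1
  have hn : Summable fun j => ‖returnProb j * z ^ j‖ := hs.norm
  have h := tsum_mul_tsum_eq_tsum_sum_antidiagonal_of_summable_norm hn hn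
  have h2 : ∀ n, ∑ p ∈ Finset.HasAntidiagonal.antidiagonal n,
      returnProb p.1 * z ^ p.1 * (returnProb p.2 * z ^ p.2) = z ^ n := by
    intro n
    have := arcMean_const n (z ^ n)
    rw [arcMean] at this
    rw [← this]
    refine Finset.sum_congr rfl fun p hp => ?_
    rw [← Finset.HasAntidiagonal.mem_antidiagonal.1 hp, pow_add]
    ring
  simp_rw [h2] at h
  rw [tsum_geometric_of_lt_one h0 h1] at h
  rw [← h, Real.sqrt_mul_self]
  exact tsum_nonneg fun j => mul_nonneg (returnProb_pos j).le (by positivity)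

/-- The arcsine mean of `1 / (3 - 2x)` is `1 / √3` in the limit, at speed `1 / n`. -/
theorem exists_abs_arcMean_inv_sub_le :
    ∃ K : ℝ, 0 ≤ K ∧ ∀ n : ℕ, 0 < n →
      |n * arcMean n (fun m => 1 / (3 * n - 2 * m)) - √3 / 3| ≤ K / n := by
  have hsum : Summable fun j : ℕ => (j : ℝ) ^ 2 * (2 / 3 : ℝ) ^ j :=
    summable_pow_mul_geometric_of_norm_lt_one 2 (by norm_num [abs_of_pos])
  refine ⟨2 / 3 * ∑' j : ℕ, (j : ℝ) ^ 2 * (2 / 3 : ℝ) ^ j, ?_, fun n hn => ?_⟩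
  · exact mul_nonneg (by norm_num) (tsum_nonneg fun j => by positivity)
  have hn' : (0 : ℝ) < n := by exact_mod_cast hn
  -- Geometric expansion of `1 / (3 - 2x)` at `x = m / n`, with ratio `2x / 3 ≤ 2 / 3`. The moment
  -- errors `j ^ 2 / n` are summable against `(2 / 3) ^ j`.
  have hmean : HasSum
      (fun j : ℕ => 1 / 3 * (2 / 3 : ℝ) ^ j * arcMean n (fun m => ((m : ℝ) / n) ^ j))
      (n * arcMean n (fun m => 1 / (3 * n - 2 * m))) := by
    have : ∀ p ∈ Finset.HasAntidiagonal.antidiagonal n, HasSum (fun j : ℕ =>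
        returnProb p.1 * returnProb p.2 * (1 / 3 * (2 / 3 * ((p.1 : ℝ) / n)) ^ j))
        (returnProb p.1 * returnProb p.2 * (n * (1 / (3 * n - 2 * p.1)))) := by
      intro p hp
      have hle : (p.1 : ℝ) ≤ n := by exact_mod_cast Finset.HasAntidiagonal.antidiagonal.fst_le hp
      have hx1 : (p.1 : ℝ) / n ≤ 1 := (div_le_one hn').2 hle
      have hx0 : 0 ≤ (p.1 : ℝ) / n := by positivity
      have hg := (hasSum_geometric_of_lt_one (r := 2 / 3 * ((p.1 : ℝ) / n)) (by positivity)
        (by linarith)).mul_left (1 / 3)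
      have he : (1 / 3 : ℝ) * (1 - 2 / 3 * ((p.1 : ℝ) / n))⁻¹ =
          n * (1 / (3 * n - 2 * p.1)) := by
        have h1 : (0 : ℝ) < 3 * n - 2 * p.1 := by linarith
        have h2 : 1 - 2 / 3 * ((p.1 : ℝ) / n) = (3 * n - 2 * p.1) / (3 * n) := by
          field_simp
        rw [h2, inv_div]
        field_simp
      rw [he] at hg
      exact hg.mul_left _
    have h := hasSum_sum this
    convert h using 1
    · funext j
      rw [arcMean, Finset.mul_sum]
      refine Finset.sum_congr rfl fun p _ => ?_
      rw [mul_pow]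
      ring
    · rw [← arcMean_const_mul, arcMean]
  have hlim : HasSum (fun j : ℕ => 1 / 3 * (2 / 3 : ℝ) ^ j * returnProb j) (√3 / 3) := by
    have hs := (summable_returnProb_mul_pow (z := 2 / 3) (by norm_num) (by norm_num)).hasSum
    rw [tsum_returnProb_mul_pow (by norm_num) (by norm_num)] at hs
    have h3 : ((1 - 2 / 3 : ℝ))⁻¹ = 3 := by norm_num
    rw [h3] at hs
    have h := hs.mul_left (1 / 3)
    rw [one_div_mul_eq_div] at h
    refine h.congr_fun fun j => ?_
    ring
  have hd := hmean.sub hlim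
  have hb : HasSum (fun j : ℕ => 2 / 3 / n * ((j : ℝ) ^ 2 * (2 / 3 : ℝ) ^ j))
      (2 / 3 / n * ∑' j : ℕ, (j : ℝ) ^ 2 * (2 / 3 : ℝ) ^ j) := hsum.hasSum.mul_left _
  have key : ∀ j : ℕ, |1 / 3 * (2 / 3 : ℝ) ^ j * arcMean n (fun m => ((m : ℝ) / n) ^ j) -
      1 / 3 * (2 / 3 : ℝ) ^ j * returnProb j| ≤ 2 / 3 / n * ((j : ℝ) ^ 2 * (2 / 3 : ℝ) ^ j) := by
    intro j
    rw [← mul_sub, abs_mul, abs_of_pos (by positivity : (0 : ℝ) < 1 / 3 * (2 / 3) ^ j)]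
    calc _ ≤ 1 / 3 * (2 / 3 : ℝ) ^ j * (2 * (j : ℝ) ^ 2 / n) := by
          gcongr
          exact abs_arcMean_pow_sub_le hn j
      _ = _ := by ring
  have hfin : 2 / 3 / n * ∑' j : ℕ, (j : ℝ) ^ 2 * (2 / 3 : ℝ) ^ j =
      (2 / 3 * ∑' j : ℕ, (j : ℝ) ^ 2 * (2 / 3 : ℝ) ^ j) / n := by ring
  rw [← hfin, abs_le]
  constructor
  · exact hasSum_le (fun j => (abs_le.1 (key j)).1) hb.neg hd
  · exact hasSum_le (fun j => (abs_le.1 (key j)).2) hd hb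

/-! ### The step law of the chain of subtree sizes. -/

/-- In a uniform tree of size `n + 1`, the probability that the child of the root below which lies
a leaf sampled from the leaf-growth measure has a subtree of size `k`. -/
noncomputable def stepProb (n k : ℕ) : ℝ :=
  2 * catalan k * catalan (n - k) / catalan (n + 1) * C k (n - k)

/-- The distribution function of `stepProb`. -/
noncomputable def stepCdf (N m : ℕ) : ℝ :=
  m * (2 * m + 1) * returnProb m * returnProb (N - m) / (N * (2 * N + 1) * returnProb N)

theorem catalan_eq_returnProb (k : ℕ) : (catalan k : ℝ) = 4 ^ k * returnProb k / (k + 1) := by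
  have h : ((k : ℝ) + 1) * catalan k = k.centralBinom := by
    exact_mod_cast succ_mul_catalan_eq_centralBinom k
  unfold returnProb
  rw [← h]
  field_simp

theorem catalan_pos (k : ℕ) : (0 : ℝ) < catalan k := by
  rw [catalan_eq_returnProb]
  have := returnProb_pos k
  positivity

theorem C_pos (a b : ℕ) : 0 < C a b := by
  unfold C
  positivity

theorem C_le_one (a b : ℕ) : C a b ≤ 1 := by
  linarith [C_add_C a b, C_pos b a]

theorem stepProb_nonneg (n k : ℕ) : 0 ≤ stepProb n k := by
  have := (C_pos k (n - k)).le
  unfold stepProb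
  positivity

theorem stepProb_eq_stepCdf_sub {n k : ℕ} (h : k ≤ n) :
    stepProb n k = stepCdf (n + 1) (k + 1) - stepCdf (n + 1) k := by
  obtain ⟨j, rfl⟩ := Nat.exists_eq_add_of_le h
  have e1 : k + j - k = j := by omega
  have e2 : k + j + 1 - (k + 1) = j := by omega
  have e3 : k + j + 1 - k = j + 1 := by omega
  have hk : returnProb (k + 1) = (k + 1 / 2) * returnProb k / (k + 1) := by
    rw [← succ_mul_returnProb_succ]
    field_simp
  have hj : returnProb (j + 1) = (j + 1 / 2) * returnProb j / (j + 1) := by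
    rw [← succ_mul_returnProb_succ]
    field_simp
  have hp := returnProb_pos (k + j + 1)
  unfold stepProb stepCdf C
  rw [catalan_eq_returnProb, catalan_eq_returnProb, catalan_eq_returnProb, e1, e2, e3, hk, hj]
  set x := returnProb k
  set y := returnProb j
  set z := returnProb (k + j + 1)
  have h4 : (4 : ℝ) ^ (k + j + 1) = 4 * 4 ^ k * 4 ^ j := by ring
  rw [h4]
  push_cast
  field_simp
  ring

theorem stepCdf_zero (N : ℕ) : stepCdf N 0 = 0 := by simp [stepCdf]

theorem stepCdf_self {N : ℕ} (hN : 0 < N) : stepCdf N N = 1 := by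
  have : (0 : ℝ) < N := by exact_mod_cast hN
  have := returnProb_pos N
  simp only [stepCdf, Nat.sub_self, returnProb_zero]
  field_simp

/-- The mean of `F` under `stepProb n`. -/
noncomputable def stepMean (n : ℕ) (F : ℕ → ℝ) : ℝ :=
  ∑ k ∈ Finset.range (n + 1), stepProb n k * F k

theorem stepMean_add (n : ℕ) (F G : ℕ → ℝ) :
    stepMean n (fun k => F k + G k) = stepMean n F + stepMean n G := by
  simp only [stepMean, mul_add, Finset.sum_add_distrib]

theorem stepMean_sub (n : ℕ) (F G : ℕ → ℝ) :
    stepMean n (fun k => F k - G k) = stepMean n F - stepMean n G := by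
  simp only [stepMean, mul_sub, Finset.sum_sub_distrib]

theorem stepMean_const_mul (n : ℕ) (c : ℝ) (F : ℕ → ℝ) :
    stepMean n (fun k => c * F k) = c * stepMean n F := by
  simp only [stepMean, Finset.mul_sum]
  exact Finset.sum_congr rfl fun k _ => by ring

theorem stepMean_mono {n : ℕ} {F G : ℕ → ℝ} (h : ∀ k ≤ n, F k ≤ G k) :
    stepMean n F ≤ stepMean n G :=
  Finset.sum_le_sum fun k hk => mul_le_mul_of_nonneg_left
    (h k (Nat.lt_succ_iff.1 (Finset.mem_range.1 hk))) (stepProb_nonneg n k)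

theorem stepMean_const (n : ℕ) (c : ℝ) : stepMean n (fun _ => c) = c := by
  unfold stepMean
  rw [← Finset.sum_mul, Finset.sum_congr rfl fun k hk =>
    stepProb_eq_stepCdf_sub (Nat.lt_succ_iff.1 (Finset.mem_range.1 hk)),
    Finset.sum_range_sub, stepCdf_self n.succ_pos, stepCdf_zero]
  ring

theorem abs_stepMean_le (n : ℕ) (F : ℕ → ℝ) : |stepMean n F| ≤ stepMean n (fun k => |F k|) := by
  refine (Finset.abs_sum_le_sum_abs _ _).trans (le_of_eq ?_)
  refine Finset.sum_congr rfl fun k _ => ?_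
  rw [abs_mul, abs_of_nonneg (stepProb_nonneg n k)]

/-! ### Summation by parts and the test functions `logHarm` and `potential`. -/

/-- The mean decrease of `logHarm` in one step from a tree of size `N`. -/
noncomputable def stepRate (N : ℕ) : ℝ := 1 / ((2 * N + 1) * returnProb N)

theorem stepRate_pos (N : ℕ) : 0 < stepRate N := by
  have := returnProb_pos N
  unfold stepRate
  positivity

theorem sum_range_sub_mul (q F : ℕ → ℝ) (M : ℕ) :
    ∑ k ∈ Finset.range M, (q (k + 1) - q k) * F k =
      q M * F M - q 0 * F 0 + ∑ k ∈ Finset.range M, q (k + 1) * (F k - F (k + 1)) := by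
  induction M with
  | zero => simp
  | succ M ih =>
    rw [Finset.sum_range_succ, Finset.sum_range_succ, ih]
    ring

/-- Abel summation against `stepCdf`: one boundary term vanishes by `hF`, the other since `stepCdf`
is `0` at `0`. What remains carries the arcsine weights, multiplied by `m * (2 * m + 1)`. -/
theorem stepMean_eq_arcMean (n : ℕ) (F : ℕ → ℝ) (hF : F (n + 1) = 0) :
    stepMean n F = stepRate (n + 1) / (n + 1 : ℕ) *
      arcMean (n + 1) (fun m => m * (2 * m + 1) * (F (m - 1) - F m)) := by
  unfold stepMean
  rw [Finset.sum_congr rfl fun k hk => by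
    rw [stepProb_eq_stepCdf_sub (Nat.lt_succ_iff.1 (Finset.mem_range.1 hk))],
    sum_range_sub_mul, hF, stepCdf_zero, arcMean_eq_sum_range,
    Finset.sum_range_succ' _ (n + 1), mul_zero, zero_mul, sub_zero, zero_add, Nat.cast_zero,
    zero_mul, zero_mul, mul_zero, add_zero, Finset.mul_sum]
  refine Finset.sum_congr rfl fun k _ => ?_
  have := returnProb_pos (n + 1)
  unfold stepRate stepCdf
  rw [Nat.add_sub_cancel]
  field_simp

/-- A variant of the harmonic numbers whose mean decrease in one step has a closed form. -/
noncomputable def logHarm (n : ℕ) : ℝ := ∑ i ∈ Finset.range n, 2 / (2 * (i : ℝ) + 3)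

theorem logHarm_zero : logHarm 0 = 0 := by simp [logHarm]

theorem logHarm_succ (n : ℕ) : logHarm (n + 1) = logHarm n + 2 / (2 * n + 3) :=
  Finset.sum_range_succ _ _

theorem logHarm_mono : Monotone logHarm := by
  refine monotone_nat_of_le_succ fun n => ?_
  rw [logHarm_succ]
  have : (0 : ℝ) ≤ 2 / (2 * n + 3) := by positivity
  linarith

theorem logHarm_sub_le {m N : ℕ} (h : m < N) :
    logHarm N - logHarm m ≤ N / (m + 1) := by
  have key : ∀ d : ℕ, logHarm (m + d) - logHarm m ≤ d / ((m : ℝ) + 1) := by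
    intro d
    induction d with
    | zero => simp
    | succ d ih =>
      rw [← add_assoc, logHarm_succ]
      have : (2 : ℝ) / (2 * (m + d : ℕ) + 3) ≤ 1 / ((m : ℝ) + 1) := by
        rw [div_le_div_iff₀ (by positivity) (by positivity)]
        push_cast
        nlinarith [(Nat.cast_nonneg d : (0 : ℝ) ≤ d)]
      push_cast at this ⊢
      rw [add_div]
      linarith
  obtain ⟨d, rfl⟩ := Nat.exists_eq_add_of_le h.le
  refine (key d).trans ?_
  gcongr
  omega

theorem stepMean_logHarm_sub (n : ℕ) :
    stepMean n (fun k => logHarm (n + 1) - logHarm k) = stepRate (n + 1) := by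
  rw [stepMean_eq_arcMean n _ (by simp)]
  have : arcMean (n + 1) (fun m => m * (2 * m + 1) *
      (logHarm (n + 1) - logHarm (m - 1) - (logHarm (n + 1) - logHarm m))) =
      arcMean (n + 1) (fun m => 2 * (m : ℝ)) := by
    refine arcMean_congr fun m _ => ?_
    cases m with
    | zero => simp
    | succ m =>
      rw [Nat.add_sub_cancel, logHarm_succ m]
      push_cast
      field_simp
      ring
  rw [this, arcMean_const_mul, arcMean_id]
  push_cast
  field_simp

/-- The difference of squares factors into an increment `2 / (2m + 3)` and a sum which
`logHarm_sub_le` bounds by `2N / (m + 1)`. The weight then cancels exactly, leaving `4N`. -/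
theorem stepMean_logHarm_sub_sq_le (n : ℕ) :
    stepMean n (fun k => (logHarm (n + 1) - logHarm k) ^ 2) ≤ 4 * stepRate (n + 1) := by
  rw [stepMean_eq_arcMean n _ (by simp)]
  have h : arcMean (n + 1) (fun m => m * (2 * m + 1) *
      ((logHarm (n + 1) - logHarm (m - 1)) ^ 2 - (logHarm (n + 1) - logHarm m) ^ 2)) ≤
      4 * (n + 1 : ℕ) := by
    rw [← arcMean_const (n + 1) (4 * (n + 1 : ℕ))]
    refine arcMean_mono fun m hm => ?_
    cases m with
    | zero =>
      simp only [Nat.cast_zero, zero_mul]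
      positivity
    | succ m =>
      have h1 := logHarm_sub_le (Nat.lt_of_succ_le hm)
      have h2 := logHarm_succ m
      have h3 := logHarm_mono hm
      rw [Nat.add_sub_cancel]
      set a := logHarm (n + 1)
      have h4 : (a - logHarm m) ^ 2 - (a - logHarm (m + 1)) ^ 2 =
          2 / (2 * m + 3) * ((a - logHarm m) + (a - logHarm (m + 1))) := by
        rw [h2]
        ring
      rw [h4]
      have h5 : (0 : ℝ) < 2 / (2 * m + 3) := by positivity
      calc _ ≤ ((m + 1 : ℕ) : ℝ) * (2 * (m + 1 : ℕ) + 1) *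
            (2 / (2 * m + 3) * (2 * ((n + 1 : ℕ) / (m + 1)))) := by
            gcongr
            linarith
        _ = _ := by
          push_cast
          field_simp
          ring
  have hr := stepRate_pos (n + 1)
  calc _ ≤ stepRate (n + 1) / (n + 1 : ℕ) * (4 * (n + 1 : ℕ)) := by gcongr
    _ = _ := by
      field_simp

/-- A bounded function whose mean decrease in one step is of order `stepRate N / N`. -/
noncomputable def potential (n : ℕ) : ℝ :=
  ∑ i ∈ Finset.range n, 1 / (((i : ℝ) + 1) * (2 * i + 3))

theorem potential_succ (n : ℕ) :
    potential (n + 1) = potential n + 1 / (((n : ℝ) + 1) * (2 * n + 3)) :=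
  Finset.sum_range_succ _ _

theorem potential_nonneg (n : ℕ) : 0 ≤ potential n :=
  Finset.sum_nonneg fun i _ => by positivity

theorem potential_le_one (n : ℕ) : potential n ≤ 1 := by
  have : potential n ≤ 1 - 1 / (n + 1) := by
    induction n with
    | zero => simp [potential]
    | succ n ih =>
      rw [potential_succ]
      have : 1 / (((n : ℝ) + 1) * (2 * n + 3)) ≤ 1 / (n + 1) - 1 / (n + 1 + 1) := by
        rw [div_sub_div _ _ (by positivity) (by positivity),
          div_le_div_iff₀ (by positivity) (by positivity)]
        nlinarith [(Nat.cast_nonneg n : (0 : ℝ) ≤ n), mul_nonneg (Nat.cast_nonneg n : (0 : ℝ) ≤ n)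
          (Nat.cast_nonneg n : (0 : ℝ) ≤ n)]
      push_cast
      linarith
  have : (0 : ℝ) ≤ 1 / (n + 1) := by positivity
  linarith

/-- The increments of `potential` are the inverses of the Abel weights, so the arcsine mean is that
of the indicator of `m ≠ 0`, namely `1 - returnProb (n + 1) ≥ 1 / 2`. -/
theorem le_stepMean_potential_sub (n : ℕ) :
    stepRate (n + 1) / (n + 1 : ℕ) ≤ 2 * stepMean n (fun k => potential (n + 1) - potential k) := by
  rw [stepMean_eq_arcMean n _ (by simp)]
  have h : arcMean (n + 1) (fun m => m * (2 * m + 1) *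
      (potential (n + 1) - potential (m - 1) - (potential (n + 1) - potential m))) =
      1 - returnProb (n + 1) := by
    have h1 : arcMean (n + 1) (fun m => if m = 0 then 1 else 0) = returnProb (n + 1) := by
      rw [arcMean_eq_sum_range]
      simp [returnProb_zero]
    have h2 := arcMean_sub (n + 1) (fun _ => 1) (fun m => if m = 0 then 1 else 0)
    rw [arcMean_const, h1] at h2
    rw [← h2]
    refine arcMean_congr fun m _ => ?_
    cases m with
    | zero => simp
    | succ m =>
      rw [Nat.add_sub_cancel, potential_succ m, if_neg (by omega)]
      push_cast
      field_simp
      ring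
  rw [h]
  have h2 := returnProb_succ_le_half n
  have hr : 0 ≤ stepRate (n + 1) / (n + 1 : ℕ) := by
    have := stepRate_pos (n + 1)
    positivity
  nlinarith

/-! ### The cost of a step: pointwise bounds and second moment. -/

/-- The cost `-log C(k, N - 1 - k)` of a step from size `N` to size `k`, extended by `0` to
`k = N`. -/
noncomputable def stepCost (N k : ℕ) : ℝ :=
  -Real.log ((k + 1) * (2 * k + 1) * (3 * N - 2 * k) / (N * (N + 1) * (2 * N + 1)))

theorem stepCost_self {N : ℕ} (hN : 0 < N) : stepCost N N = 0 := by
  have : (0 : ℝ) < N := by exact_mod_cast hN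
  have h : ((N : ℝ) + 1) * (2 * N + 1) * (3 * N - 2 * N) / (N * (N + 1) * (2 * N + 1)) = 1 := by
    field_simp
    ring
  rw [stepCost, h, Real.log_one, neg_zero]

theorem neg_log_C (k j : ℕ) : -Real.log (C k j) = stepCost (k + j + 1) k := by
  unfold C stepCost
  congr 2
  push_cast
  congr 1 <;> ring

theorem stepCost_nonneg {N k : ℕ} (hN : 0 < N) (h : k ≤ N) : 0 ≤ stepCost N k := by
  rcases h.eq_or_lt with rfl | h
  · exact (stepCost_self hN).ge
  · obtain ⟨j, rfl⟩ : ∃ j, N = k + j + 1 := ⟨N - 1 - k, by omega⟩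
    rw [← neg_log_C]
    exact neg_nonneg.2 (Real.log_nonpos (C_pos k j).le (C_le_one k j))

theorem stepCost_le {N k : ℕ} (hN : 0 < N) (h : k ≤ N) : stepCost N k ≤ 6 * N / (k + 1) := by
  have hN' : (1 : ℝ) ≤ N := by exact_mod_cast hN
  have hk : (k : ℝ) ≤ N := by exact_mod_cast h
  have hk0 : (0 : ℝ) ≤ k := Nat.cast_nonneg k
  set z : ℝ := (k + 1) * (2 * k + 1) * (3 * N - 2 * k) / (N * (N + 1) * (2 * N + 1)) with hz
  -- Since `y ^ 2 ≤ z`, the cost `-log z` is at most `2 * log (1 / y) ≤ 2 / y`.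
  set y : ℝ := (k + 1) / (3 * N) with hy
  have hy0 : 0 < y := by positivity
  have hyz : y ^ 2 ≤ z := by
    have h1 : (k + 1) * (2 * k + 1) * N / (N * (N + 1) * (2 * N + 1)) ≤ z := by
      rw [hz]
      gcongr
      linarith
    refine le_trans ?_ h1
    rw [hy, div_pow, div_le_div_iff₀ (by positivity) (by positivity)]
    have h2 : ((N : ℝ) + 1) * (2 * N + 1) ≤ 9 * N ^ 2 := by nlinarith
    have h3 : ((k : ℝ) + 1) ^ 2 ≤ (k + 1) * (2 * k + 1) := by nlinarith
    calc ((k : ℝ) + 1) ^ 2 * (N * (N + 1) * (2 * N + 1))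
        = ((k : ℝ) + 1) ^ 2 * (((N : ℝ) + 1) * (2 * N + 1)) * N := by ring
      _ ≤ ((k : ℝ) + 1) * (2 * k + 1) * (9 * N ^ 2) * N := by gcongr
      _ = _ := by ring
  have h5 : 2 * Real.log y ≤ Real.log z := by
    have := Real.log_le_log (by positivity) hyz
    rwa [Real.log_pow, Nat.cast_ofNat] at this
  have h6 := Real.log_le_sub_one_of_pos (inv_pos.2 hy0)
  rw [Real.log_inv] at h6
  have h7 : 2 * y⁻¹ = 6 * N / (k + 1) := by
    rw [hy, inv_div]
    ring
  rw [← h7, stepCost, ← hz]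
  linarith

theorem abs_log_one_add_sub_le {x : ℝ} (hx : 0 ≤ x) : |Real.log (1 + x) - x| ≤ x ^ 2 := by
  have hp : 0 < 1 + x := by linarith
  have h1 := Real.log_le_sub_one_of_pos hp
  have h2 := Real.one_sub_inv_le_log_of_pos hp
  have h3 : 1 - (1 + x)⁻¹ = x - x ^ 2 / (1 + x) := by
    field_simp
    ring
  have h4 : x ^ 2 / (1 + x) ≤ x ^ 2 := div_le_self (by positivity) (by linarith)
  rw [abs_le]
  constructor <;> nlinarith

/-- Linearisation of the three logarithms in a cost increment. The form `4 / (2x + 1)`, with `x = m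
+ 1`, replaces `1 / x + 2 / (2x - 1)` so that it cancels a factor of the Abel weight. The constant
is `12 = 1 + 4 + 4 + 3`: three quadratic errors and this replacement. -/
theorem abs_stepCost_sub_le {N m : ℕ} (h : m + 1 ≤ N) :
    |stepCost N m - stepCost N (m + 1) - (4 / (2 * (m + 1) + 1) - 2 / (3 * N - 2 * (m + 1)))| ≤
      12 / ((m : ℝ) + 1) ^ 2 := by
  have hN : (m : ℝ) + 1 ≤ N := by exact_mod_cast h
  have hm0 : (0 : ℝ) ≤ m := Nat.cast_nonneg m
  have hN0 : (0 : ℝ) < N := by linarith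
  set x : ℝ := (m : ℝ) + 1 with hx
  have hx1 : 1 ≤ x := by linarith
  have hd : 0 < 3 * N - 2 * x := by linarith
  have hd2 : 0 < 2 * x - 1 := by linarith
  obtain ⟨d, hdd⟩ : ∃ d, d = 3 * N - 2 * x := ⟨_, rfl⟩
  obtain ⟨w, hw⟩ : ∃ w, w = 2 * x - 1 := ⟨_, rfl⟩
  have hd0 : 0 < d := hdd ▸ hd
  have hw0 : 0 < w := hw ▸ hd2
  have hxw : 2 * x + 1 = w + 2 := by linarith
  have hmain : stepCost N m - stepCost N (m + 1) =
      Real.log (1 + 1 / x) + Real.log (1 + 2 / (2 * x - 1)) -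
        Real.log (1 + 2 / (3 * N - 2 * x)) := by
    have hm : (m : ℝ) = x - 1 := by linarith
    unfold stepCost
    rw [← Real.log_mul (by positivity) (by positivity),
      ← Real.log_div (by positivity) (by positivity), neg_sub_neg,
      ← Real.log_div]
    · congr 1
      push_cast
      rw [hm]
      have e1 : 3 * (N : ℝ) - 2 * (x - 1) = 3 * N - 2 * x + 2 := by ring
      have e2 : 2 * (x - 1) + 1 = 2 * x - 1 := by ring
      have e3 : x - 1 + 1 = x := by ring
      rw [e1, e2, e3, hxw, ← hdd, ← hw]
      field_simp
    · push_cast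
      rw [← hx]
      positivity
    · rw [hm]
      have e1 : 3 * (N : ℝ) - 2 * (x - 1) ≠ 0 := by linarith
      have e2 : 2 * (x - 1) + 1 ≠ 0 := by linarith
      have e3 : x - 1 + 1 ≠ 0 := by linarith
      positivity
  have a1 := abs_log_one_add_sub_le (x := 1 / x) (by positivity)
  have a2 := abs_log_one_add_sub_le (x := 2 / (2 * x - 1)) (by positivity)
  have a3 := abs_log_one_add_sub_le (x := 2 / (3 * N - 2 * x)) (by positivity)
  have b1 : (1 / x) ^ 2 = 1 / x ^ 2 := by rw [div_pow, one_pow]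
  have b2 : (2 / (2 * x - 1)) ^ 2 ≤ 4 / x ^ 2 := by
    rw [div_pow, div_le_div_iff₀ (by positivity) (by positivity)]
    nlinarith
  have b3 : (2 / (3 * N - 2 * x)) ^ 2 ≤ 4 / x ^ 2 := by
    rw [div_pow, div_le_div_iff₀ (by positivity) (by positivity)]
    nlinarith
  have c0 : 1 / x + 2 / (2 * x - 1) - 4 / (2 * x + 1) =
      (6 * x - 1) / (x * (2 * x - 1) * (2 * x + 1)) := by
    have e1 : 6 * x - 1 = 3 * w + 2 := by linarith
    have e2 : x = (w + 1) / 2 := by linarith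
    rw [hxw, ← hw, e1, e2]
    field_simp
    ring
  have c1 : 0 ≤ 1 / x + 2 / (2 * x - 1) - 4 / (2 * x + 1) := by
    rw [c0]
    have : 0 < 6 * x - 1 := by linarith
    positivity
  have c2 : 1 / x + 2 / (2 * x - 1) - 4 / (2 * x + 1) ≤ 3 / x ^ 2 := by
    rw [c0, div_le_div_iff₀ (by positivity) (by positivity)]
    nlinarith [mul_pos (by linarith : 0 < x) (by linarith : 0 < x),
      mul_pos (by positivity : 0 < x) (mul_pos (by linarith : 0 < x) (by linarith : 0 < x))]
  have e12 : 12 / x ^ 2 = 1 / x ^ 2 + 4 / x ^ 2 + 4 / x ^ 2 + 3 / x ^ 2 := by ring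
  rw [hmain, e12]
  rw [b1] at a1
  rw [abs_le] at a1 a2 a3 ⊢
  constructor <;> linarith [a1.1, a1.2, a2.1, a2.2, a3.1, a3.2]

theorem stepCost_sub_le {N m : ℕ} (h : m + 1 ≤ N) :
    stepCost N m - stepCost N (m + 1) ≤ 14 / ((m : ℝ) + 1) := by
  have h1 := (abs_le.1 (abs_stepCost_sub_le h)).2
  have hN : (m : ℝ) + 1 ≤ N := by exact_mod_cast h
  have hm0 : (0 : ℝ) ≤ m := Nat.cast_nonneg m
  have h2 : (0 : ℝ) ≤ 2 / (3 * N - 2 * (m + 1)) := div_nonneg (by norm_num) (by linarith)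
  have h3 : (4 : ℝ) / (2 * (m + 1) + 1) ≤ 2 / (m + 1) := by
    rw [div_le_div_iff₀ (by positivity) (by positivity)]
    linarith
  have h4 : (12 : ℝ) / ((m : ℝ) + 1) ^ 2 ≤ 12 / (m + 1) := by
    gcongr
    nlinarith
  have h5 : (14 : ℝ) / ((m : ℝ) + 1) = 2 / (m + 1) + 12 / (m + 1) := by ring
  linarith

theorem stepMean_stepCost_sq_le (n : ℕ) :
    stepMean n (fun k => stepCost (n + 1) k ^ 2) ≤ 504 * stepRate (n + 1) := by
  rw [stepMean_eq_arcMean n _ (by rw [stepCost_self n.succ_pos]; simp)]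
  have h : arcMean (n + 1) (fun m => m * (2 * m + 1) *
      (stepCost (n + 1) (m - 1) ^ 2 - stepCost (n + 1) m ^ 2)) ≤ 504 * (n + 1 : ℕ) := by
    rw [← arcMean_const (n + 1) (504 * (n + 1 : ℕ))]
    refine arcMean_mono fun m hm => ?_
    cases m with
    | zero =>
      simp only [Nat.cast_zero, zero_mul]
      positivity
    | succ m =>
      rw [Nat.add_sub_cancel]
      have h1 := stepCost_sub_le hm
      have h2 := stepCost_le n.succ_pos (Nat.le_of_succ_le hm)
      have h3 := stepCost_le n.succ_pos hm
      have h4 := stepCost_nonneg n.succ_pos (Nat.le_of_succ_le hm)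
      have h5 := stepCost_nonneg n.succ_pos hm
      have h6 : 6 * ((n + 1 : ℕ) : ℝ) / ((m + 1 : ℕ) + 1) ≤ 6 * (n + 1 : ℕ) / (m + 1) := by
        gcongr
        linarith
      have h7 : stepCost (n + 1) m ^ 2 - stepCost (n + 1) (m + 1) ^ 2 ≤
          14 / ((m : ℝ) + 1) * (12 * (n + 1 : ℕ) / (m + 1)) := by
        have : stepCost (n + 1) m ^ 2 - stepCost (n + 1) (m + 1) ^ 2 =
          (stepCost (n + 1) m - stepCost (n + 1) (m + 1)) *
            (stepCost (n + 1) m + stepCost (n + 1) (m + 1)) := by ring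
        rw [this]
        have e : 12 * ((n + 1 : ℕ) : ℝ) / (m + 1) =
          6 * (n + 1 : ℕ) / (m + 1) + 6 * (n + 1 : ℕ) / (m + 1) := by ring
        refine mul_le_mul h1 ?_ (by linarith) (by positivity)
        rw [e]
        exact add_le_add h2 (h3.trans h6)
      calc _ ≤ ((m + 1 : ℕ) : ℝ) * (2 * (m + 1 : ℕ) + 1) *
            (14 / ((m : ℝ) + 1) * (12 * (n + 1 : ℕ) / (m + 1))) := by gcongr
        _ = (2 * (m + 1) + 1) / ((m : ℝ) + 1) * 168 * (n + 1 : ℕ) := by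
          push_cast
          field_simp
          ring
        _ ≤ 3 * 168 * (n + 1 : ℕ) := by
          gcongr
          rw [div_le_iff₀ (by positivity)]
          linarith [(Nat.cast_nonneg m : (0 : ℝ) ≤ m)]
        _ = _ := by ring
  have hr := stepRate_pos (n + 1)
  calc _ ≤ stepRate (n + 1) / (n + 1 : ℕ) * (504 * (n + 1 : ℕ)) := by gcongr
    _ = _ := by
      field_simp

/-! ### Centred costs: one step, then sums along the chain. -/

/-- The centred cost of a step. -/
noncomputable def stepDev (N k : ℕ) : ℝ :=
  stepCost N k - gammaExp * (logHarm N - logHarm k)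

theorem exists_abs_stepMean_stepDev_le :
    ∃ K : ℝ, 0 ≤ K ∧ ∀ n : ℕ,
      |stepMean n (stepDev (n + 1))| ≤ K * (stepRate (n + 1) / (n + 1 : ℕ)) := by
  obtain ⟨K, hK, hT⟩ := exists_abs_arcMean_inv_sub_le
  refine ⟨12 * K + √3 + 37, by positivity, fun n => ?_⟩
  have hT := hT (n + 1) n.succ_pos
  set N : ℕ := n + 1 with hNdef
  have hN : (1 : ℝ) ≤ N := by
    rw [hNdef]
    push_cast
    linarith [(Nat.cast_nonneg n : (0 : ℝ) ≤ n)]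
  set T := arcMean N (fun m => 1 / (3 * N - 2 * m)) with hTdef
  have hcost : stepMean n (stepCost N) = stepRate N / N *
      arcMean N (fun m => m * (2 * m + 1) * (stepCost N (m - 1) - stepCost N m)) :=
    stepMean_eq_arcMean n _ (stepCost_self n.succ_pos)
  -- Euclidean division of `2m(2m + 1)` by `3N - 2m`, which leaves `T` as the only mean not computed
  -- exactly. With `T ≈ √3 / (3N)` the value is `(6 - 3√3) * N + O(1)`, whence `γ`.
  have hm1 : arcMean N (fun m => 4 * (m : ℝ) - (3 * N * (3 * N + 1) * (1 / (3 * N - 2 * m)) -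
      (6 * N + 1) + (3 * N - 2 * m))) = 6 * N + 1 - 3 * N * (3 * N + 1) * T := by
    simp only [arcMean_sub, arcMean_add, arcMean_const_mul, arcMean_const, arcMean_id, ← hTdef]
    ring
  have herr : |arcMean N (fun m => m * (2 * m + 1) * (stepCost N (m - 1) - stepCost N m)) -
      (6 * N + 1 - 3 * N * (3 * N + 1) * T)| ≤ 36 := by
    rw [← hm1, ← arcMean_sub]
    refine abs_arcMean_le fun m hm => ?_
    have hmN : (m : ℝ) ≤ N := by exact_mod_cast hm
    obtain ⟨d, hd⟩ : ∃ d, d = 3 * (N : ℝ) - 2 * m := ⟨_, rfl⟩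
    have hd0 : 0 < d := by linarith
    have e : 4 * (m : ℝ) - (3 * N * (3 * N + 1) * (1 / (3 * N - 2 * m)) -
      (6 * N + 1) + (3 * N - 2 * m)) =
        m * (2 * m + 1) * (4 / (2 * m + 1) - 2 / (3 * N - 2 * m)) := by
      have e1 : (N : ℝ) = (d + 2 * m) / 3 := by linarith
      rw [← hd, e1]
      field_simp
      ring
    rw [e, ← mul_sub]
    cases m with
    | zero => simp
    | succ m =>
      rw [Nat.add_sub_cancel, abs_mul, abs_of_nonneg (by positivity)]
      have h := abs_stepCost_sub_le hm
      push_cast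
      calc _ ≤ ((m : ℝ) + 1) * (2 * (m + 1) + 1) * (12 / ((m : ℝ) + 1) ^ 2) := by gcongr
        _ = (2 * (m + 1) + 1) / ((m : ℝ) + 1) * 12 := by
          field_simp
        _ ≤ 3 * 12 := by
          gcongr
          rw [div_le_iff₀ (by positivity)]
          linarith [(Nat.cast_nonneg m : (0 : ℝ) ≤ m)]
        _ = _ := by norm_num
  have hmean : stepMean n (stepDev N) = stepRate N / N *
      (arcMean N (fun m => m * (2 * m + 1) * (stepCost N (m - 1) - stepCost N m)) -
        gammaExp * N) := by
    have : stepMean n (stepDev N) =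
        stepMean n (stepCost N) - gammaExp * stepMean n (fun k => logHarm N - logHarm k) := by
      rw [← stepMean_const_mul, ← stepMean_sub]
      rfl
    rw [this, hcost, stepMean_logHarm_sub, ← hNdef, mul_sub]
    congr 1
    field_simp
  have hr : 0 ≤ stepRate N / N := by
    have := stepRate_pos N
    positivity
  rw [hmean, abs_mul, abs_of_nonneg hr, mul_comm]
  refine mul_le_mul_of_nonneg_right ?_ hr
  set S := arcMean N (fun m => m * (2 * m + 1) * (stepCost N (m - 1) - stepCost N m))
  -- The speed `1 / N` in `hT` is exactly what keeps this term bounded.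
  have h9 : |9 * N * (N * T - √3 / 3)| ≤ 9 * K := by
    rw [abs_mul, abs_of_nonneg (by positivity)]
    calc _ ≤ 9 * (N : ℝ) * (K / N) := by gcongr
      _ = _ := by field_simp
  have h3 : |N * T - √3 / 3| ≤ K := hT.trans (div_le_self hK hN)
  have hgoal : S - gammaExp * N = (S - (6 * N + 1 - 3 * N * (3 * N + 1) * T)) -
      9 * N * (N * T - √3 / 3) - 3 * (N * T - √3 / 3) - √3 + 1 := by
    unfold gammaExp
    ring
  rw [hgoal]
  have hs := Real.sqrt_nonneg 3
  rw [abs_le] at herr h9 h3 ⊢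
  constructor <;> linarith [herr.1, herr.2, h9.1, h9.2, h3.1, h3.2]

theorem gammaExp_nonneg : 0 ≤ gammaExp := by
  have : √3 ≤ 2 := Real.sqrt_le_iff.2 ⟨by norm_num, by norm_num⟩
  unfold gammaExp
  linarith

/-- Both the cost and the decrease of `logHarm` are nonnegative, so `|stepDev|` is at most their
sum, that is `stepDev` plus `2γ` times the decrease. -/
theorem exists_stepMean_abs_stepDev_le :
    ∃ K : ℝ, 0 ≤ K ∧ ∀ n : ℕ, stepMean n (fun k => |stepDev (n + 1) k|) ≤ K * stepRate (n + 1) := by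
  obtain ⟨K, hK, h⟩ := exists_abs_stepMean_stepDev_le
  refine ⟨K + 2 * gammaExp, by linarith [gammaExp_nonneg], fun n => ?_⟩
  have h1 : stepMean n (fun k => |stepDev (n + 1) k|) ≤
      stepMean n (fun k => stepDev (n + 1) k +
        2 * gammaExp * (logHarm (n + 1) - logHarm k)) := by
    refine stepMean_mono fun k hk => ?_
    have hc := stepCost_nonneg n.succ_pos (Nat.le_succ_of_le hk)
    have hl := mul_nonneg gammaExp_nonneg (sub_nonneg.2 (logHarm_mono (Nat.le_succ_of_le hk)))
    unfold stepDev
    rw [abs_le]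
    constructor <;> linarith
  refine h1.trans ?_
  rw [stepMean_add, stepMean_const_mul, stepMean_logHarm_sub, add_mul]
  gcongr
  refine (le_abs_self _).trans ((h n).trans ?_)
  gcongr
  refine div_le_self (stepRate_pos _).le ?_
  push_cast
  linarith [(Nat.cast_nonneg n : (0 : ℝ) ≤ n)]

theorem exists_stepMean_stepDev_sq_le :
    ∃ K : ℝ, 0 ≤ K ∧ ∀ n : ℕ, stepMean n (fun k => stepDev (n + 1) k ^ 2) ≤ K * stepRate (n + 1) := by
  refine ⟨2 * 504 + 2 * gammaExp ^ 2 * 4, by positivity, fun n => ?_⟩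
  calc _ ≤ stepMean n (fun k => 2 * stepCost (n + 1) k ^ 2 +
        2 * gammaExp ^ 2 * (logHarm (n + 1) - logHarm k) ^ 2) := by
        refine stepMean_mono fun k _ => ?_
        unfold stepDev
        nlinarith [sq_nonneg (stepCost (n + 1) k + gammaExp * (logHarm (n + 1) - logHarm k))]
    _ ≤ 2 * (504 * stepRate (n + 1)) + 2 * gammaExp ^ 2 * (4 * stepRate (n + 1)) := by
        rw [stepMean_add, stepMean_const_mul, stepMean_const_mul]
        gcongr
        · exact stepMean_stepCost_sq_le n
        · exact stepMean_logHarm_sub_sq_le n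
    _ = _ := by ring

/-- The first moment of a sum of centred costs along the chain is bounded. -/
theorem exists_abs_le_of_eq_stepMean {U : ℕ → ℝ} (h0 : U 0 = 0)
    (hU : ∀ n, U (n + 1) = stepMean n (fun k => stepDev (n + 1) k + U k)) :
    ∃ K : ℝ, 0 ≤ K ∧ ∀ n, |U n| ≤ K := by
  obtain ⟨K, hK, h⟩ := exists_abs_stepMean_stepDev_le
  -- The mean drop of `2 * K * potential` in one step dominates the bias `K * stepRate N / N` of
  -- that step.
  have key : ∀ n, |U n| ≤ 2 * K * potential n := by
    intro n
    induction n using Nat.strong_induction_on with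
    | _ n ih =>
      cases n with
      | zero => simp [h0, potential]
      | succ n =>
        rw [hU, stepMean_add]
        have h1 : |stepMean n U| ≤ 2 * K * stepMean n potential := by
          refine (abs_stepMean_le n U).trans ?_
          rw [← stepMean_const_mul]
          exact stepMean_mono fun k hk => ih k (Nat.lt_succ_of_le hk)
        have h2 := le_stepMean_potential_sub n
        rw [stepMean_sub, stepMean_const] at h2
        have h3 := mul_le_mul_of_nonneg_left h2 hK
        refine (abs_add_le _ _).trans ?_
        have h4 := h n
        change |stepMean n fun k => stepDev (n + 1) k| ≤ _ at h4
        linarith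
  refine ⟨2 * K, by positivity, fun n => (key n).trans ?_⟩
  exact mul_le_of_le_one_right (by positivity) (potential_le_one n)

/-- The second moment of a sum of centred costs along the chain is at most logarithmic. -/
theorem exists_le_logHarm_of_eq_stepMean {U W : ℕ → ℝ} (hU0 : U 0 = 0) (hW0 : W 0 = 0)
    (hU : ∀ n, U (n + 1) = stepMean n (fun k => stepDev (n + 1) k + U k))
    (hW : ∀ n, W (n + 1) = stepMean n (fun k =>
      stepDev (n + 1) k ^ 2 + 2 * stepDev (n + 1) k * U k + W k)) :
    ∃ K : ℝ, 0 ≤ K ∧ ∀ n, W n ≤ K * logHarm n := by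
  obtain ⟨A, hA, hUA⟩ := exists_abs_le_of_eq_stepMean hU0 hU
  obtain ⟨B, hB, hB'⟩ := exists_stepMean_abs_stepDev_le
  obtain ⟨D, hD, hD'⟩ := exists_stepMean_stepDev_sq_le
  refine ⟨D + 2 * A * B, by positivity, fun n => ?_⟩
  induction n using Nat.strong_induction_on with
  | _ n ih =>
    cases n with
    | zero => simp [hW0, logHarm_zero]
    | succ n =>
      have h1 : W (n + 1) ≤ stepMean n (fun k => stepDev (n + 1) k ^ 2 +
          2 * A * |stepDev (n + 1) k| + (D + 2 * A * B) * logHarm k) := by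
        rw [hW]
        refine stepMean_mono fun k hk => ?_
        have h2 := ih k (Nat.lt_succ_of_le hk)
        -- As the later costs have mean bounded by `A`, the cross term is also `O(stepRate N)` in
        -- mean, and the drop of `logHarm` pays for it.
        have h3 : stepDev (n + 1) k * U k ≤ |stepDev (n + 1) k| * A := by
          refine (le_abs_self _).trans ?_
          rw [abs_mul]
          exact mul_le_mul_of_nonneg_left (hUA k) (abs_nonneg _)
        linarith
      refine h1.trans ?_
      rw [stepMean_add, stepMean_add, stepMean_const_mul, stepMean_const_mul]
      have h4 := stepMean_logHarm_sub n
      rw [stepMean_sub, stepMean_const] at h4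
      have h5 : stepMean n logHarm = logHarm (n + 1) - stepRate (n + 1) := by linarith
      have h6 := mul_le_mul_of_nonneg_left (hB' n) (by positivity : 0 ≤ 2 * A)
      have h7 := hD' n
      have h8 : stepMean n (fun k => logHarm k) = logHarm (n + 1) - stepRate (n + 1) := h5
      rw [h8]
      linarith

/-! ### Recursion at the root for the moments of `logDev` in a fixed tree. -/

theorem sum_leaves_node (u : Unit) (a b : BinaryTree Unit) (g : List Bool → ℝ) :
    ∑ l ∈ leaves (.node u a b), g l =
      ∑ l ∈ leaves a, g (false :: l) + ∑ l ∈ leaves b, g (true :: l) := by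
  have hd : Disjoint ((leaves a).image (List.cons false))
      ((leaves b).image (List.cons true)) := by
    rw [Finset.disjoint_left]
    intro x hx hy
    simp only [Finset.mem_image] at hx hy
    obtain ⟨y, -, rfl⟩ := hx
    obtain ⟨z, -, hz⟩ := hy
    simp at hz
  rw [leaves, Finset.sum_union hd, Finset.sum_image (by simp), Finset.sum_image (by simp)]

theorem mass_pos {t : BinaryTree Unit} {l : List Bool} (h : l ∈ leaves t) : 0 < mass t l := by
  induction t generalizing l with
  | nil =>
    rw [leaves, Finset.mem_singleton] at h
    simp [h, mass]
  | node u a b iha ihb =>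
    rw [leaves, Finset.mem_union, Finset.mem_image, Finset.mem_image] at h
    rcases h with ⟨l, hl, rfl⟩ | ⟨l, hl, rfl⟩
    · exact mul_pos (C_pos _ _) (iha hl)
    · exact mul_pos (C_pos _ _) (ihb hl)

theorem mass_eq_zero {t : BinaryTree Unit} {l : List Bool} (h : l ∉ leaves t) : mass t l = 0 := by
  induction t generalizing l with
  | nil =>
    cases l with
    | nil => simp [leaves] at h
    | cons => rfl
  | node u a b iha ihb =>
    match l with
    | [] => rfl
    | false :: l =>
      have : l ∉ leaves a := fun hl => h (by simp [leaves, hl])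
      rw [mass, iha this, mul_zero]
    | true :: l =>
      have : l ∉ leaves b := fun hl => h (by simp [leaves, hl])
      rw [mass, ihb this, mul_zero]

/-- The deviation of `-log ν_t(l)` from `γ` times the logarithm of the size of `t`. -/
noncomputable def logDev (t : BinaryTree Unit) (l : List Bool) : ℝ :=
  -Real.log (mass t l) - gammaExp * logHarm t.numNodes

theorem logDev_false_cons (u : Unit) {a b : BinaryTree Unit} {l : List Bool} (h : l ∈ leaves a) :
    logDev (.node u a b) (false :: l) =
      stepDev (a.numNodes + b.numNodes + 1) a.numNodes + logDev a l := by
  unfold logDev stepDev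
  rw [mass, Real.log_mul (C_pos _ _).ne' (mass_pos h).ne', ← neg_log_C, BinaryTree.numNodes]
  ring

theorem logDev_true_cons (u : Unit) {a b : BinaryTree Unit} {l : List Bool} (h : l ∈ leaves b) :
    logDev (.node u a b) (true :: l) =
      stepDev (a.numNodes + b.numNodes + 1) b.numNodes + logDev b l := by
  unfold logDev stepDev
  rw [mass, Real.log_mul (C_pos _ _).ne' (mass_pos h).ne', add_comm a.numNodes, ← neg_log_C,
    BinaryTree.numNodes, add_comm a.numNodes]
  ring

/-- The mean of `logDev t` under the leaf-growth measure. -/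
noncomputable def devMean (t : BinaryTree Unit) : ℝ := ∑ l ∈ leaves t, mass t l * logDev t l

/-- The second moment of `logDev t` under the leaf-growth measure. -/
noncomputable def devSq (t : BinaryTree Unit) : ℝ := ∑ l ∈ leaves t, mass t l * logDev t l ^ 2

theorem sum_mass (t : BinaryTree Unit) : ∑ l ∈ leaves t, mass t l = 1 := leafGrowth_leaves t

theorem sum_mass_mul_add_logDev (t : BinaryTree Unit) (x : ℝ) :
    ∑ l ∈ leaves t, mass t l * (x + logDev t l) = x + devMean t := by
  simp only [mul_add, Finset.sum_add_distrib, ← Finset.sum_mul, sum_mass, one_mul, devMean]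

theorem sum_mass_mul_add_logDev_sq (t : BinaryTree Unit) (x : ℝ) :
    ∑ l ∈ leaves t, mass t l * (x + logDev t l) ^ 2 = x ^ 2 + 2 * x * devMean t + devSq t := by
  have h : ∀ l, mass t l * (x + logDev t l) ^ 2 =
      mass t l * x ^ 2 + 2 * x * (mass t l * logDev t l) + mass t l * logDev t l ^ 2 :=
    fun l => by ring
  simp only [h, Finset.sum_add_distrib, ← Finset.sum_mul, ← Finset.mul_sum, sum_mass, one_mul,
    devMean, devSq]

theorem devMean_node (u : Unit) (a b : BinaryTree Unit) :
    devMean (.node u a b) =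
      C a.numNodes b.numNodes *
        (stepDev (a.numNodes + b.numNodes + 1) a.numNodes + devMean a) +
      C b.numNodes a.numNodes *
        (stepDev (a.numNodes + b.numNodes + 1) b.numNodes + devMean b) := by
  rw [devMean, sum_leaves_node, ← sum_mass_mul_add_logDev, ← sum_mass_mul_add_logDev,
    Finset.mul_sum, Finset.mul_sum]
  congr 1
  · refine Finset.sum_congr rfl fun l hl => ?_
    rw [logDev_false_cons u hl, mass, mul_assoc]
  · refine Finset.sum_congr rfl fun l hl => ?_
    rw [logDev_true_cons u hl, mass, mul_assoc]

theorem devSq_node (u : Unit) (a b : BinaryTree Unit) :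
    devSq (.node u a b) =
      C a.numNodes b.numNodes *
        (stepDev (a.numNodes + b.numNodes + 1) a.numNodes ^ 2 +
          2 * stepDev (a.numNodes + b.numNodes + 1) a.numNodes * devMean a + devSq a) +
      C b.numNodes a.numNodes *
        (stepDev (a.numNodes + b.numNodes + 1) b.numNodes ^ 2 +
          2 * stepDev (a.numNodes + b.numNodes + 1) b.numNodes * devMean b + devSq b) := by
  rw [devSq, sum_leaves_node, ← sum_mass_mul_add_logDev_sq, ← sum_mass_mul_add_logDev_sq,
    Finset.mul_sum, Finset.mul_sum]
  congr 1
  · refine Finset.sum_congr rfl fun l hl => ?_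
    rw [logDev_false_cons u hl, mass, mul_assoc]
  · refine Finset.sum_congr rfl fun l hl => ?_
    rw [logDev_true_cons u hl, mass, mul_assoc]

/-! ### Averaging over uniform trees. -/

/-- The mean of `g` over the uniform plane binary trees of size `n`. -/
noncomputable def unifMean (n : ℕ) (g : BinaryTree Unit → ℝ) : ℝ :=
  (∑ t ∈ BinaryTree.treesOfNumNodesEq n, g t) / catalan n

theorem unifMean_add (n : ℕ) (g h : BinaryTree Unit → ℝ) :
    unifMean n (fun t => g t + h t) = unifMean n g + unifMean n h := by
  simp only [unifMean, Finset.sum_add_distrib, add_div]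

theorem unifMean_const_mul (n : ℕ) (c : ℝ) (g : BinaryTree Unit → ℝ) :
    unifMean n (fun t => c * g t) = c * unifMean n g := by
  simp only [unifMean, ← Finset.mul_sum, mul_div_assoc]

theorem unifMean_congr {n : ℕ} {g h : BinaryTree Unit → ℝ} (H : ∀ t, t.numNodes = n → g t = h t) :
    unifMean n g = unifMean n h := by
  unfold unifMean
  rw [Finset.sum_congr rfl fun t ht => H t (BinaryTree.mem_treesOfNumNodesEq.1 ht)]

theorem unifMean_mono {n : ℕ} {g h : BinaryTree Unit → ℝ} (H : ∀ t, t.numNodes = n → g t ≤ h t) :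
    unifMean n g ≤ unifMean n h := by
  unfold unifMean
  exact div_le_div_of_nonneg_right
    (Finset.sum_le_sum fun t ht => H t (BinaryTree.mem_treesOfNumNodesEq.1 ht)) (catalan_pos n).le

theorem unifMean_const (n : ℕ) (c : ℝ) : unifMean n (fun _ => c) = c := by
  have := catalan_pos n
  simp only [unifMean, Finset.sum_const, BinaryTree.treesOfNumNodesEq_card_eq_catalan, nsmul_eq_mul]
  field_simp

theorem sum_treesOfNumNodesEq_succ (n : ℕ) (g : BinaryTree Unit → ℝ) :
    ∑ t ∈ BinaryTree.treesOfNumNodesEq (n + 1), g t =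
      ∑ p ∈ Finset.HasAntidiagonal.antidiagonal n, ∑ a ∈ BinaryTree.treesOfNumNodesEq p.1,
        ∑ b ∈ BinaryTree.treesOfNumNodesEq p.2, g (.node () a b) := by
  rw [BinaryTree.treesOfNumNodesEq_succ, Finset.sum_biUnion]
  · refine Finset.sum_congr rfl fun p _ => ?_
    rw [Finset.sum_map, Finset.sum_product]
    rfl
  · simp_rw [Set.PairwiseDisjoint, Set.Pairwise, Finset.disjoint_left]
    aesop

/-- The Markov property: given their sizes, the two subtrees of the root are independent and
uniform. Exchanging left and right makes the two terms equal, hence the factor `2` in `stepProb`. -/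
theorem unifMean_succ (n : ℕ) (g φ : BinaryTree Unit → ℝ)
    (hg : ∀ a b : BinaryTree Unit, a.numNodes + b.numNodes = n → g (.node () a b) =
      C a.numNodes b.numNodes * φ a + C b.numNodes a.numNodes * φ b) :
    unifMean (n + 1) g = stepMean n (fun k => unifMean k φ) := by
  set Φ : ℕ → ℝ := fun k => ∑ t ∈ BinaryTree.treesOfNumNodesEq k, φ t with hΦ
  have h1 : ∑ t ∈ BinaryTree.treesOfNumNodesEq (n + 1), g t =
      ∑ p ∈ Finset.HasAntidiagonal.antidiagonal n,
        (C p.1 p.2 * catalan p.2 * Φ p.1 + C p.2 p.1 * catalan p.1 * Φ p.2) := by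
    rw [sum_treesOfNumNodesEq_succ]
    refine Finset.sum_congr rfl fun p hp => ?_
    have hp' := Finset.HasAntidiagonal.mem_antidiagonal.1 hp
    have : ∀ a ∈ BinaryTree.treesOfNumNodesEq p.1, ∀ b ∈ BinaryTree.treesOfNumNodesEq p.2,
        g (.node () a b) = C p.1 p.2 * φ a + C p.2 p.1 * φ b := by
      intro a ha b hb
      rw [BinaryTree.mem_treesOfNumNodesEq] at ha hb
      rw [hg a b (by omega), ha, hb]
    rw [Finset.sum_congr rfl fun a ha => Finset.sum_congr rfl fun b hb => this a ha b hb]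
    simp only [Finset.sum_add_distrib, Finset.sum_const, nsmul_eq_mul,
      BinaryTree.treesOfNumNodesEq_card_eq_catalan, ← Finset.mul_sum, hΦ]
    ring
  have h2 : ∑ p ∈ Finset.HasAntidiagonal.antidiagonal n, C p.2 p.1 * catalan p.1 * Φ p.2 =
      ∑ p ∈ Finset.HasAntidiagonal.antidiagonal n, C p.1 p.2 * catalan p.2 * Φ p.1 := by
    rw [← Finset.Nat.sum_antidiagonal_swap]
    rfl
  rw [unifMean, h1, Finset.sum_add_distrib, h2,
    Finset.Nat.sum_antidiagonal_eq_sum_range_succ (fun i j => C i j * catalan j * Φ i) n, ← two_mul,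
    Finset.mul_sum, Finset.sum_div, stepMean]
  refine Finset.sum_congr rfl fun k _ => ?_
  have := catalan_pos k
  have := catalan_pos (n + 1)
  unfold stepProb unifMean
  field_simp
  rfl

theorem unifMean_devMean_succ (n : ℕ) :
    unifMean (n + 1) devMean = stepMean n (fun k => stepDev (n + 1) k + unifMean k devMean) := by
  rw [unifMean_succ n devMean (fun t => stepDev (n + 1) t.numNodes + devMean t)
    fun a b h => by rw [devMean_node, h]]
  congr 1
  funext k
  rw [unifMean_add, unifMean_congr (h := fun _ => stepDev (n + 1) k) (fun t ht => by rw [ht]),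
    unifMean_const]

theorem unifMean_devSq_succ (n : ℕ) :
    unifMean (n + 1) devSq = stepMean n (fun k => stepDev (n + 1) k ^ 2 +
      2 * stepDev (n + 1) k * unifMean k devMean + unifMean k devSq) := by
  rw [unifMean_succ n devSq (fun t => stepDev (n + 1) t.numNodes ^ 2 +
    2 * stepDev (n + 1) t.numNodes * devMean t + devSq t)
    fun a b h => by rw [devSq_node, h]]
  congr 1
  funext k
  rw [unifMean_congr (h := fun t => stepDev (n + 1) k ^ 2 +
    2 * stepDev (n + 1) k * devMean t + devSq t) (fun t ht => by rw [ht]), unifMean_add,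
    unifMean_add, unifMean_const, unifMean_const_mul]

theorem exists_unifMean_devSq_le :
    ∃ K : ℝ, 0 ≤ K ∧ ∀ n, unifMean n devSq ≤ K * logHarm n := by
  refine exists_le_logHarm_of_eq_stepMean (U := fun n => unifMean n devMean) ?_ ?_
    unifMean_devMean_succ unifMean_devSq_succ
  · simp [unifMean, devMean, leaves, logDev, mass, logHarm_zero]
  · simp [unifMean, devSq, leaves, logDev, mass, logHarm_zero]

/-! ### Typical leaves: concentration and counting. -/

theorem harmonic_eq_logHarm_add_potential (n : ℕ) :
    (harmonic n : ℝ) = logHarm n + potential n := by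
  induction n with
  | zero => simp [logHarm_zero, potential]
  | succ n ih =>
    rw [logHarm_succ, potential_succ, harmonic_succ]
    push_cast
    rw [ih]
    field_simp
    ring

theorem abs_logHarm_sub_log_le {n : ℕ} (hn : 0 < n) : |logHarm n - Real.log n| ≤ 1 := by
  have h1 := harmonic_le_one_add_log n
  have h2 := log_add_one_le_harmonic n
  rw [harmonic_eq_logHarm_add_potential] at h1 h2
  have h3 := potential_nonneg n
  have h4 := potential_le_one n
  have h5 : Real.log n ≤ Real.log ((n + 1 : ℕ) : ℝ) :=
    Real.log_le_log (by exact_mod_cast hn) (by exact_mod_cast n.le_succ)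
  rw [abs_le]
  constructor <;> linarith

/-- The leaves of `t` whose mass is not of the form `n ^ (-γ + θ)` with `|θ| < ε`. -/
noncomputable def atypicalLeaves (n : ℕ) (ε : ℝ) (t : BinaryTree Unit) : Finset (List Bool) :=
  (leaves t).filter fun l => ε * Real.log n ≤ |-Real.log (mass t l) - gammaExp * Real.log n|

theorem leafGrowth_mono {t : BinaryTree Unit} {A B : Finset (List Bool)} (hB : B ⊆ leaves t)
    (h : A ⊆ B) : leafGrowth t A ≤ leafGrowth t B :=
  Finset.sum_le_sum_of_subset_of_nonneg h fun _ hl _ => (mass_pos (hB hl)).le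

theorem leafGrowth_nonneg {t : BinaryTree Unit} {A : Finset (List Bool)} (hA : A ⊆ leaves t) :
    0 ≤ leafGrowth t A :=
  Finset.sum_nonneg fun _ hl => (mass_pos (hA hl)).le

/-- Chebyshev's inequality under the leaf-growth measure. Half of `ε * log n` absorbs the error, at
most `γ`, of replacing `logHarm n` by `log n`. -/
theorem sq_mul_leafGrowth_atypicalLeaves_le {n : ℕ} (hn : 0 < n) {ε : ℝ} (hε : 0 < ε)
    (hlog : gammaExp ≤ ε / 2 * Real.log n) {t : BinaryTree Unit} (ht : t.numNodes = n) :
    (ε / 2 * Real.log n) ^ 2 * leafGrowth t (atypicalLeaves n ε t) ≤ devSq t := by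
  have hl0 : 0 ≤ Real.log n := Real.log_natCast_nonneg n
  unfold leafGrowth devSq
  rw [Finset.mul_sum]
  calc _ ≤ ∑ l ∈ atypicalLeaves n ε t, mass t l * logDev t l ^ 2 := by
        refine Finset.sum_le_sum fun l hl => ?_
        rw [atypicalLeaves, Finset.mem_filter] at hl
        rw [mul_comm]
        refine mul_le_mul_of_nonneg_left ?_ (mass_pos hl.1).le
        rw [← sq_abs (logDev t l)]
        refine pow_le_pow_left₀ (by positivity) ?_ 2
        have h1 : |gammaExp * (logHarm n - Real.log n)| ≤ gammaExp := by
          rw [abs_mul, abs_of_nonneg gammaExp_nonneg]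
          exact mul_le_of_le_one_right gammaExp_nonneg (abs_logHarm_sub_log_le hn)
        have h2 := abs_add_le (logDev t l) (gammaExp * (logHarm n - Real.log n))
        have h3 : logDev t l + gammaExp * (logHarm n - Real.log n) =
            -Real.log (mass t l) - gammaExp * Real.log n := by
          rw [logDev, ht]
          ring
        rw [h3] at h2
        linarith [hl.2]
    _ ≤ _ := Finset.sum_le_sum_of_subset_of_nonneg (Finset.filter_subset _ _)
        fun l hl _ => mul_nonneg (mass_pos hl).le (sq_nonneg _)

theorem tendsto_log_natCast : Tendsto (fun n : ℕ => Real.log n) atTop atTop :=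
  Real.tendsto_log_atTop.comp tendsto_natCast_atTop_atTop

theorem tendsto_unifMean_atypicalLeaves {ε : ℝ} (hε : 0 < ε) :
    Tendsto (fun n => unifMean n fun t => leafGrowth t (atypicalLeaves n ε t)) atTop (𝓝 0) := by
  obtain ⟨K, hK, h⟩ := exists_unifMean_devSq_le
  have hlim : Tendsto (fun n : ℕ => 8 * K / ε ^ 2 * (Real.log n)⁻¹) atTop (𝓝 0) := by
    simpa using (tendsto_inv_atTop_zero.comp tendsto_log_natCast).const_mul (8 * K / ε ^ 2)
  refine squeeze_zero' (Eventually.of_forall fun n => ?_) ?_ hlim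
  · rw [← unifMean_const n 0]
    exact unifMean_mono fun t _ => leafGrowth_nonneg (Finset.filter_subset _ _)
  · filter_upwards [eventually_gt_atTop 0, tendsto_log_natCast.eventually_ge_atTop 1,
      (tendsto_log_natCast.const_mul_atTop (half_pos hε)).eventually_ge_atTop gammaExp]
      with n hn hlog1 hlog
    have h1 := unifMean_mono (n := n) fun t ht => sq_mul_leafGrowth_atypicalLeaves_le hn hε hlog ht
    rw [unifMean_const_mul] at h1
    have h2 : logHarm n ≤ 2 * Real.log n := by
      linarith [(abs_le.1 (abs_logHarm_sub_log_le hn)).2]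
    have h3 : K * logHarm n ≤ K * (2 * Real.log n) := mul_le_mul_of_nonneg_left h2 hK
    have hpos : 0 < Real.log n := by linarith
    have h4 := (h1.trans (h n)).trans h3
    rw [mul_comm, ← le_div_iff₀ (by positivity)] at h4
    refine h4.trans (le_of_eq ?_)
    field_simp
    ring

theorem rpow_le_mass_of_notMem_atypicalLeaves {n : ℕ} (hn : 0 < n) {ε : ℝ} {t : BinaryTree Unit}
    {l : List Bool} (hl : l ∈ leaves t) (h : l ∉ atypicalLeaves n ε t) :
    (n : ℝ) ^ (-gammaExp - ε) ≤ mass t l ∧ mass t l ≤ (n : ℝ) ^ (-gammaExp + ε) := by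
  have hn' : (0 : ℝ) < n := by exact_mod_cast hn
  rw [atypicalLeaves, Finset.mem_filter, not_and, not_le] at h
  have h := abs_lt.1 (h hl)
  rw [← Real.log_le_log_iff (Real.rpow_pos_of_pos hn' _) (mass_pos hl),
    ← Real.log_le_log_iff (mass_pos hl) (Real.rpow_pos_of_pos hn' _), Real.log_rpow hn',
    Real.log_rpow hn']
  constructor <;> nlinarith [h.1, h.2]

theorem one_sub_leafGrowth_leavesWithMassIn_le {n : ℕ} (hn : 0 < n) (ε : ℝ)
    (t : BinaryTree Unit) :
    1 - leafGrowth t (leavesWithMassIn t ((n : ℝ) ^ (-gammaExp - ε)) ((n : ℝ) ^ (-gammaExp + ε))) ≤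
      leafGrowth t (atypicalLeaves n ε t) := by
  set A := leavesWithMassIn t ((n : ℝ) ^ (-gammaExp - ε)) ((n : ℝ) ^ (-gammaExp + ε)) with hA
  have hAl : A ⊆ leaves t := Finset.filter_subset _ _
  have h1 : leafGrowth t (leaves t \ A) + leafGrowth t A = 1 := by
    rw [← leafGrowth_leaves t]
    exact Finset.sum_sdiff hAl
  have h2 : leafGrowth t (leaves t \ A) ≤ leafGrowth t (atypicalLeaves n ε t) := by
    refine leafGrowth_mono (Finset.filter_subset _ _) fun l hl => ?_
    rw [Finset.mem_sdiff] at hl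
    by_contra hc
    exact hl.2 (Finset.mem_filter.2 ⟨hl.1, rpow_le_mass_of_notMem_atypicalLeaves hn hl.1 hc⟩)
  linarith

theorem leafGrowth_le_one {t : BinaryTree Unit} {A : Finset (List Bool)} (hA : A ⊆ leaves t) :
    leafGrowth t A ≤ 1 :=
  leafGrowth_leaves t ▸ leafGrowth_mono subset_rfl hA

theorem card_leavesWithMassIn_le {n : ℕ} (hn : 0 < n) (x y : ℝ) (t : BinaryTree Unit) :
    ((leavesWithMassIn t ((n : ℝ) ^ (-x)) y).card : ℝ) ≤ (n : ℝ) ^ x := by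
  have hn' : (0 : ℝ) < n := by exact_mod_cast hn
  have h1 := leafGrowth_le_one (Finset.filter_subset _ _ :
    leavesWithMassIn t ((n : ℝ) ^ (-x)) y ⊆ leaves t)
  have h2 : (leavesWithMassIn t ((n : ℝ) ^ (-x)) y).card * (n : ℝ) ^ (-x) ≤
      leafGrowth t (leavesWithMassIn t ((n : ℝ) ^ (-x)) y) := by
    rw [← nsmul_eq_mul]
    exact Finset.card_nsmul_le_sum _ _ _ fun l hl => (Finset.mem_filter.1 hl).2.1
  generalize (leavesWithMassIn t ((n : ℝ) ^ (-x)) y).card = c at h2 ⊢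
  -- The last rewrite restores the threshold `n ^ (-x)` inside `leavesWithMassIn`, which the first
  -- one also altered.
  rw [Real.rpow_neg hn'.le, ← div_eq_mul_inv, ← Real.rpow_neg hn'.le] at h2
  exact (div_le_one (Real.rpow_pos_of_pos hn' x)).1 (h2.trans h1)

theorem maxLeafGrowth_nonneg (t : BinaryTree Unit) (x : ℝ) : 0 ≤ maxLeafGrowth t x := by
  refine Real.sSup_nonneg ?_
  rintro m ⟨A, hA, -, rfl⟩
  exact leafGrowth_nonneg hA

/-- At most `n ^ (γ - ε)` typical leaves, each of mass at most `n ^ (-γ + ε / 2)`, weigh together at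
most `n ^ (-ε / 2)`. -/
theorem maxLeafGrowth_le {n : ℕ} (hn : 0 < n) {ε : ℝ} (t : BinaryTree Unit) :
    maxLeafGrowth t ((n : ℝ) ^ (gammaExp - ε)) ≤
      leafGrowth t (atypicalLeaves n (ε / 2) t) + (n : ℝ) ^ (-(ε / 2)) := by
  have hn' : (0 : ℝ) < n := by exact_mod_cast hn
  refine csSup_le ⟨0, ∅, by simp, ?_, by simp [leafGrowth]⟩ ?_
  · simpa using (Real.rpow_pos_of_pos hn' _).le
  rintro m ⟨A, hA, hcard, rfl⟩
  have h1 : leafGrowth t A = leafGrowth t (A.filter (· ∈ atypicalLeaves n (ε / 2) t)) +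
      leafGrowth t (A.filter (· ∉ atypicalLeaves n (ε / 2) t)) :=
    (Finset.sum_filter_add_sum_filter_not A _ _).symm
  rw [h1]
  refine add_le_add (leafGrowth_mono (Finset.filter_subset _ _)
    fun l hl => (Finset.mem_filter.1 hl).2) ?_
  have h2 : leafGrowth t (A.filter (· ∉ atypicalLeaves n (ε / 2) t)) ≤
      (A.filter (· ∉ atypicalLeaves n (ε / 2) t)).card • (n : ℝ) ^ (-gammaExp + ε / 2) := by
    refine Finset.sum_le_card_nsmul _ _ _ fun l hl => ?_
    rw [Finset.mem_filter] at hl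
    exact (rpow_le_mass_of_notMem_atypicalLeaves hn (hA hl.1) hl.2).2
  rw [nsmul_eq_mul] at h2
  refine h2.trans ?_
  have h3 : ((A.filter (· ∉ atypicalLeaves n (ε / 2) t)).card : ℝ) ≤ (n : ℝ) ^ (gammaExp - ε) :=
    le_trans (by exact_mod_cast Finset.card_filter_le _ _) hcard
  calc _ ≤ (n : ℝ) ^ (gammaExp - ε) * (n : ℝ) ^ (-gammaExp + ε / 2) := by gcongr
    _ = _ := by
      rw [← Real.rpow_add hn']
      congr 1
      ring

/-! ### From means over trees to probabilities. -/

section Probability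

variable {Ω : Type*} [MeasurableSpace Ω] {P : Measure Ω} {n : ℕ} {T : Ω → BinaryTree Unit}

theorem measure_eq_of_hasLaw_uniformOn
    (hT : HasLaw T (uniformOn {t : BinaryTree Unit | t.numNodes = n}) P)
    (p : BinaryTree Unit → Prop) [DecidablePred p] :
    P {ω | p (T ω)} = ENNReal.ofReal
      (((BinaryTree.treesOfNumNodesEq n).filter p).card / catalan n) := by
  rw [hT.measure_eq (MeasurableSet.of_discrete (s := {t | p t})),
    ← BinaryTree.coe_treesOfNumNodesEq, ← uniformOn_inter_self (Finset.finite_toSet _)]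
  have h : ((BinaryTree.treesOfNumNodesEq n : Set (BinaryTree Unit)) ∩ {t | p t}) =
      ((BinaryTree.treesOfNumNodesEq n).filter p : Finset (BinaryTree Unit)) := by
    ext t
    simp
  rw [h, uniformOn_apply_finset, Finset.inter_eq_right.2 (Finset.filter_subset _ _),
    BinaryTree.treesOfNumNodesEq_card_eq_catalan, ENNReal.ofReal_div_of_pos (catalan_pos n),
    ENNReal.ofReal_natCast, ENNReal.ofReal_natCast]

theorem measure_le_unifMean_div
    (hT : HasLaw T (uniformOn {t : BinaryTree Unit | t.numNodes = n}) P)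
    {g : BinaryTree Unit → ℝ} (hg : ∀ t, 0 ≤ g t) {η : ℝ} (hη : 0 < η) :
    P {ω | η ≤ g (T ω)} ≤ ENNReal.ofReal (unifMean n g / η) := by
  classical
  rw [measure_eq_of_hasLaw_uniformOn hT (fun t => η ≤ g t)]
  refine ENNReal.ofReal_le_ofReal ?_
  have h : ((BinaryTree.treesOfNumNodesEq n).filter fun t => η ≤ g t).card • η ≤
      ∑ t ∈ BinaryTree.treesOfNumNodesEq n, g t :=
    (Finset.card_nsmul_le_sum _ _ _ fun t ht => (Finset.mem_filter.1 ht).2).trans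
      (Finset.sum_le_sum_of_subset_of_nonneg (Finset.filter_subset _ _) fun t _ _ => hg t)
  rw [nsmul_eq_mul] at h
  rw [le_div_iff₀ hη, unifMean, div_mul_eq_mul_div]
  exact div_le_div_of_nonneg_right h (catalan_pos n).le

theorem measure_eq_tree
    (hT : HasLaw T (uniformOn {t : BinaryTree Unit | t.numNodes = n}) P)
    {t : BinaryTree Unit} (ht : t ∈ BinaryTree.treesOfNumNodesEq n) :
    P {ω | T ω = t} = ENNReal.ofReal (1 / catalan n) := by
  rw [measure_eq_of_hasLaw_uniformOn hT (fun s => s = t), Finset.filter_eq', if_pos ht,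
    Finset.card_singleton, Nat.cast_one]

theorem measure_numNodes_ne
    (hT : HasLaw T (uniformOn {t : BinaryTree Unit | t.numNodes = n}) P) :
    P {ω | (T ω).numNodes ≠ n} = 0 := by
  rw [measure_eq_of_hasLaw_uniformOn hT (fun t => t.numNodes ≠ n), Finset.filter_false_of_mem]
  · simp
  · intro t ht
    simpa using ht

/-- If, given a uniform tree, a leaf is sampled from its leaf-growth measure, the probability that
this leaf is in a prescribed random set is at most the mean mass of this set. -/
theorem measure_mem_le_unifMean
    (hT : HasLaw T (uniformOn {t : BinaryTree Unit | t.numNodes = n}) P) {L : Ω → List Bool}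
    (hL : ∀ t l, P {ω | T ω = t ∧ L ω = l} = P {ω | T ω = t} * ENNReal.ofReal (mass t l))
    (A : BinaryTree Unit → Finset (List Bool)) (hA : ∀ t, A t ⊆ leaves t) :
    P {ω | L ω ∈ leaves (T ω) → L ω ∈ A (T ω)} ≤
      ENNReal.ofReal (unifMean n fun t => leafGrowth t (A t)) := by
  -- The first two sets, where the tree has the wrong size or the word is not a leaf, are null; the
  -- third is a finite union whose probabilities are given by `hL`.
  have hsub : {ω | L ω ∈ leaves (T ω) → L ω ∈ A (T ω)} ⊆
      {ω | (T ω).numNodes ≠ n} ∪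
        ((⋃ t ∈ BinaryTree.treesOfNumNodesEq n, ⋃ l ∈ {l | l ∉ leaves t},
          {ω | T ω = t ∧ L ω = l}) ∪
        (⋃ t ∈ BinaryTree.treesOfNumNodesEq n, ⋃ l ∈ A t, {ω | T ω = t ∧ L ω = l})) := by
    intro ω hω
    by_cases hn : (T ω).numNodes = n
    · right
      have hmem : T ω ∈ BinaryTree.treesOfNumNodesEq n := BinaryTree.mem_treesOfNumNodesEq.2 hn
      by_cases hl : L ω ∈ leaves (T ω)
      · right
        exact Set.mem_biUnion hmem (Set.mem_biUnion (hω hl) ⟨rfl, rfl⟩)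
      · left
        exact Set.mem_biUnion hmem (Set.mem_biUnion (x := L ω) hl ⟨rfl, rfl⟩)
    · exact Or.inl hn
  refine (measure_mono hsub).trans ((measure_union_le _ _).trans ?_)
  rw [measure_numNodes_ne hT, zero_add]
  refine (measure_union_le _ _).trans ?_
  have hz : P (⋃ t ∈ BinaryTree.treesOfNumNodesEq n, ⋃ l ∈ {l | l ∉ leaves t},
      {ω | T ω = t ∧ L ω = l}) = 0 := by
    refine (measure_biUnion_null_iff (Finset.countable_toSet _)).2 fun t _ => ?_
    refine (measure_biUnion_null_iff (Set.to_countable _)).2 fun l hl => ?_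
    rw [hL, mass_eq_zero hl, ENNReal.ofReal_zero, mul_zero]
  rw [hz, zero_add]
  refine (measure_biUnion_finset_le _ _).trans ?_
  have hc := catalan_pos n
  have hnn : ∀ t, 0 ≤ leafGrowth t (A t) := fun t => leafGrowth_nonneg (hA t)
  rw [unifMean, Finset.sum_div, ENNReal.ofReal_sum_of_nonneg fun t _ => div_nonneg (hnn t) hc.le]
  refine Finset.sum_le_sum fun t ht => ?_
  refine (measure_biUnion_finset_le _ _).trans (le_of_eq ?_)
  simp_rw [hL, measure_eq_tree hT ht]
  rw [← Finset.mul_sum, ← ENNReal.ofReal_sum_of_nonneg fun l hl => (mass_pos (hA t hl)).le,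
    ← ENNReal.ofReal_mul (by positivity)]
  congr 1
  rw [leafGrowth]
  ring

end Probability

theorem tendsto_measure_le_atypicalLeaves {Ω : Type*} [MeasurableSpace Ω] {P : Measure Ω}
    {τ : ℕ → Ω → BinaryTree Unit}
    (hτ : ∀ n, HasLaw (τ n) (uniformOn {t : BinaryTree Unit | t.numNodes = n}) P)
    {ε η : ℝ} (hε : 0 < ε) (hη : 0 < η) :
    Tendsto (fun n => P {ω | η ≤ leafGrowth (τ n ω) (atypicalLeaves n ε (τ n ω))})
      atTop (𝓝 0) := by
  have h := ENNReal.tendsto_ofReal ((tendsto_unifMean_atypicalLeaves hε).div_const η)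
  rw [zero_div, ENNReal.ofReal_zero] at h
  exact tendsto_of_tendsto_of_tendsto_of_le_of_le tendsto_const_nhds h (fun _ => zero_le)
    fun n => measure_le_unifMean_div (hτ n)
      (fun t => leafGrowth_nonneg (Finset.filter_subset _ _)) hη

end LeafGrowth

/-! ### Conclusion. -/

theorem tendsto_measure_of_eventually_subset {Ω : Type*} [MeasurableSpace Ω] {P : Measure Ω}
    {s t : ℕ → Set Ω} (ht : Tendsto (fun n => P (t n)) atTop (𝓝 0))
    (h : ∀ᶠ n in atTop, s n ⊆ t n) : Tendsto (fun n => P (s n)) atTop (𝓝 0) :=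
  tendsto_of_tendsto_of_tendsto_of_le_of_le' tendsto_const_nhds ht
    (Eventually.of_forall fun _ => zero_le) (h.mono fun _ hn => measure_mono hn)

theorem mainTheorem1 {Ω : Type*} [MeasurableSpace Ω] (P : Measure Ω) [IsProbabilityMeasure P]
    (τ : ℕ → Ω → BinaryTree Unit)
    -- `τ n` is uniformly distributed on the plane binary trees of size `n`
    (hτ : ∀ n, HasLaw (τ n) (uniformOn {t : BinaryTree Unit | t.numNodes = n}) P) :
    -- the mass of the leaves of mass `n ^ (-γ ± ε)` tends to one in probability
    (∀ ε : ℝ, 0 < ε →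
      TendstoInMeasure P
        (fun (n : ℕ) ω => LeafGrowth.leafGrowth (τ n ω)
          (LeafGrowth.leavesWithMassIn (τ n ω)
            ((n : ℝ) ^ (-LeafGrowth.gammaExp - ε)) ((n : ℝ) ^ (-LeafGrowth.gammaExp + ε))))
        atTop (fun _ => (1 : ℝ))) ∧
    -- with high probability, at most `n ^ (γ + ε)` leaves carry mass at least `1 - δ`
    (∀ ε : ℝ, 0 < ε → ∀ δ : ℝ, 0 < δ → δ < 1 →
      Tendsto
        (fun n : ℕ => P {ω | ∃ A ⊆ LeafGrowth.leaves (τ n ω),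
          1 - δ ≤ LeafGrowth.leafGrowth (τ n ω) A ∧
          (A.card : ℝ) ≤ (n : ℝ) ^ (LeafGrowth.gammaExp + ε)})
        atTop (𝓝 1)) ∧
    -- the maximal mass of a set of at most `n ^ (γ - ε)` leaves tends to zero in probability
    (∀ ε : ℝ, 0 < ε →
      TendstoInMeasure P
        (fun (n : ℕ) ω =>
          LeafGrowth.maxLeafGrowth (τ n ω) ((n : ℝ) ^ (LeafGrowth.gammaExp - ε)))
        atTop (fun _ => (0 : ℝ))) ∧
    -- if `L n` is, conditionally on `τ n`, a leaf sampled from the leaf-growth measure of `τ n`,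
    -- then its mass `M` satisfies `-log M / log n → γ` in probability
    (∀ L : ℕ → Ω → List Bool,
      (∀ n t l, P {ω | τ n ω = t ∧ L n ω = l} =
        P {ω | τ n ω = t} * ENNReal.ofReal (LeafGrowth.mass t l)) →
      TendstoInMeasure P
        (fun (n : ℕ) ω => -Real.log (LeafGrowth.mass (τ n ω) (L n ω)) / Real.log n)
        atTop (fun _ => LeafGrowth.gammaExp)) := by
  refine ⟨fun ε hε => ?_, fun ε hε δ hδ _ => ?_, fun ε hε => ?_, fun L hL => ?_⟩
  · rw [tendstoInMeasure_iff_dist]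
    intro η hη
    refine tendsto_measure_of_eventually_subset
      (LeafGrowth.tendsto_measure_le_atypicalLeaves hτ hε hη) ?_
    filter_upwards [eventually_gt_atTop 0] with n hn ω hω
    rw [Set.mem_ofPred_eq, dist_comm, Real.dist_eq, abs_of_nonneg] at hω
    · exact hω.trans (LeafGrowth.one_sub_leafGrowth_leavesWithMassIn_le hn ε _)
    · exact sub_nonneg.2 (LeafGrowth.leafGrowth_le_one (Finset.filter_subset _ _))
  · set s : ℕ → Set Ω := fun n => {ω | ∃ A ⊆ LeafGrowth.leaves (τ n ω),
      1 - δ ≤ LeafGrowth.leafGrowth (τ n ω) A ∧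
      (A.card : ℝ) ≤ (n : ℝ) ^ (LeafGrowth.gammaExp + ε)} with hs
    have hc : Tendsto (fun n => P (s n)ᶜ) atTop (𝓝 0) := by
      refine tendsto_measure_of_eventually_subset
        (LeafGrowth.tendsto_measure_le_atypicalLeaves hτ hε hδ) ?_
      filter_upwards [eventually_gt_atTop 0] with n hn ω hω
      by_contra hlt
      rw [Set.mem_ofPred_eq, not_le] at hlt
      refine hω ⟨LeafGrowth.leavesWithMassIn (τ n ω) ((n : ℝ) ^ (-LeafGrowth.gammaExp - ε))
        ((n : ℝ) ^ (-LeafGrowth.gammaExp + ε)), Finset.filter_subset _ _, ?_, ?_⟩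
      · linarith [LeafGrowth.one_sub_leafGrowth_leavesWithMassIn_le hn ε (τ n ω)]
      · have := LeafGrowth.card_leavesWithMassIn_le hn (LeafGrowth.gammaExp + ε)
          ((n : ℝ) ^ (-LeafGrowth.gammaExp + ε)) (τ n ω)
        rwa [neg_add'] at this
    -- The bound `1 - P (s n)ᶜ ≤ P (s n)` needs only subadditivity, not the measurability of `s n`.
    have h1 := ENNReal.Tendsto.sub (tendsto_const_nhds (x := (1 : ENNReal))) hc
      (Or.inl ENNReal.one_ne_top)
    rw [tsub_zero] at h1
    refine tendsto_of_tendsto_of_tendsto_of_le_of_le h1 tendsto_const_nhds (fun n => ?_)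
      fun n => prob_le_one
    rw [tsub_le_iff_right, ← measure_univ (μ := P), ← Set.union_compl_self (s n)]
    exact measure_union_le _ _
  · rw [tendstoInMeasure_iff_dist]
    intro η hη
    refine tendsto_measure_of_eventually_subset
      (LeafGrowth.tendsto_measure_le_atypicalLeaves hτ (half_pos hε) (half_pos hη)) ?_
    have hlim : Tendsto (fun n : ℕ => (n : ℝ) ^ (-(ε / 2))) atTop (𝓝 0) :=
      (tendsto_rpow_neg_atTop (half_pos hε)).comp tendsto_natCast_atTop_atTop
    filter_upwards [eventually_gt_atTop 0, hlim.eventually (gt_mem_nhds (half_pos hη))]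
      with n hn hsmall ω hω
    rw [Set.mem_ofPred_eq, Real.dist_eq, sub_zero,
      abs_of_nonneg (LeafGrowth.maxLeafGrowth_nonneg _ _)] at hω
    have := LeafGrowth.maxLeafGrowth_le hn (ε := ε) (τ n ω)
    rw [Set.mem_ofPred_eq]
    linarith
  · rw [tendstoInMeasure_iff_dist]
    intro ε hε
    have h := ENNReal.tendsto_ofReal (LeafGrowth.tendsto_unifMean_atypicalLeaves hε)
    rw [ENNReal.ofReal_zero] at h
    refine tendsto_of_tendsto_of_tendsto_of_le_of_le' tendsto_const_nhds h
      (Eventually.of_forall fun _ => zero_le) ?_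
    filter_upwards [LeafGrowth.tendsto_log_natCast.eventually_gt_atTop 0] with n hlog
    refine (measure_mono fun ω hω => ?_).trans (LeafGrowth.measure_mem_le_unifMean (hτ n) (hL n)
      (LeafGrowth.atypicalLeaves n ε) fun t => Finset.filter_subset _ _)
    intro hl
    rw [Set.mem_ofPred_eq, Real.dist_eq] at hω
    refine Finset.mem_filter.2 ⟨hl, ?_⟩
    have e : -Real.log (LeafGrowth.mass (τ n ω) (L n ω)) - LeafGrowth.gammaExp * Real.log n =
        (-Real.log (LeafGrowth.mass (τ n ω) (L n ω)) / Real.log n - LeafGrowth.gammaExp) *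
          Real.log n := by
      field_simp
    rw [e, abs_mul, abs_of_pos hlog]
    exact mul_le_mul_of_nonneg_right hω hlog.le
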